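/- Let $G=(V,E_\to,E_\leftrightarrow)$ be a mixed graph: $V$ is a finite set, $E_\to$ is a set of directed edges $i\to j$ and $E_\leftrightarrow$ a set of (unoriented) bi-directed edges $i\leftrightarrow j$, both with $i\neq j$; the same two nodes may be joined by several edges of different kind or direction. Put $\mathrm{pa}(i)=\{j: j\to i\in E_\to\}$ and $\mathrm{sib}(i)=\{j: j\leftrightarrow i\in E_\leftrightarrow\}$, and let $G_{-i}$ be the subgraph induced on $V\setminus\{i\}$. A half-collider path is a path $i_1,\dots,i_k$ ($k\ge 1$, vertices not necessarily distinct) whose edges are all bi-directed, or whose first edge is $i_1\to i_2$ and whose other edges are all bi-directed; the trivial path $i_1$ and the single edge $i_1\to i_2$ are allowed. Its bi-directed portion is $\{i_1,\dots,i_k\}$ in the first case and $\{i_2,\dots,i_k\}$ in the second. A system of half-collider paths from $S_b$ to $S_e$ is a collection $\pi^1,\dots,\pi^s$ with $s=|S_b|=|S_e|$ such that each $\pi^l$ is a half-collider path from a node of $S_b$ to a node of $S_e$, each node of $S_b$ is the first node of some $\pi^l$, and each node of $S_e$ is the last node of some $\pi^l$. Let $\mathbf B(G)$ be the set of real $V\times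 V$ matrices $B=(\beta_{ij})$ with $I-B$ invertible and $\beta_{ij}=0$ whenever $j\to i\notin E_\to$, and let $\mathbf\Omega(G)$ be the set of symmetric positive definite real $V\times V$ matrices $\Omega=(\omega_{ij})$ with $\omega_{ij}=0$ whenever $i\ne j$ and $i\leftrightarrow j\notin E_\leftrightarrow$. Let $N\ge|V|$. For $Y\in\mathbb R^{V\times N}$ and $S=\frac1N YY^T$ let $$\ell_{G,Y}(\Omega,B)=-\log\det\bigl((I-B)^{-1}\Omega(I-B)^{-T}\bigr)-\mathrm{tr}\bigl\{(I-B)^T\Omega^{-1}(I-B)S\bigr\},\qquad (B,\Omega)\in\mathbf B(G)\times\mathbf\Omega(G).$$ The block update at node $i$ replaces the current pair $(B,\Omega)$ by a maximizer of $\ell_{G,Y}$ over those pairs in $\mathbf B(G)\times\mathbf\Omega(G)$ that agree with $(B,\Omega)$ outside the $i$-th row of $B$ and outside the $i$-th row and column of $\Omega$; it is unique and feasible if exactly one such maximizer exists. Fix an order of the nodes. One iteration of the block-coordinate descent (BCD) algorithm carries out the block updates at all nodes $i\in V$, one after the other, in this order. "Generic" means: outside a set of Lebesgue measure zero, in the coordinates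 formed by the entries of $Y$ and the free entries $\beta_{ij}$ ($j\to i\in E_\to$) of $B_0$ and $\omega_{ii}$ ($i\in V$), $\omega_{ij}$ ($i\leftrightarrow j\in E_\leftrightarrow$) of $\Omega_0$. Then the following two statements are equivalent: (a) For every $i\in V$, the induced subgraph $G_{-i}$ contains a system of half-collider paths from a subset of $V\setminus(\mathrm{pa}(i)\cup\{i\})$ to $\mathrm{sib}(i)$ whose bi-directed portions are pairwise disjoint. (b) For generic triples $(Y,B_0,\Omega_0)\in\mathbb R^{V\times N}\times\mathbf B(G)\times\mathbf\Omega(G)$, any finite number of iterations of the BCD algorithm for $\ell_{G,Y}$ started at $(B_0,\Omega_0)$ have unique and feasible block updates. -/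

import Mathlib

open MeasureTheory

/-- A mixed graph on the vertex set `V`: directed edges `i → j` (written `dir i j`) and bi-directed
edges `i ↔ j` (written `bi.Adj i j`), neither of them with self-loops. The same pair of nodes may
carry edges of both kinds and directed edges in both directions. -/
structure MixedGraph (V : Type*) where
  dir : V → V → Prop
  dir_irrefl : ∀ i, ¬ dir i i
  bi : SimpleGraph V

namespace MixedGraph

/-! ### Graphical notions -/

section Graph

variable {V : Type*}

/-- The parents of `i`. -/
def pa (G : MixedGraph V) (i : V) : Set V := {j | G.dir j i}

/-- The siblings of `i`. -/
def sib (G : MixedGraph V) (i : V) : Set V := {j | G.bi.Adj j i}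

/-- The induced subgraph on a set of nodes. -/
def induce (G : MixedGraph V) (s : Set V) : MixedGraph s where
  dir a b := G.dir a b
  dir_irrefl a := G.dir_irrefl a
  bi := G.bi.induce s

/-- A half-collider path from `a` to `b`, with not necessarily distinct vertices: either all of its
edges are bi-directed (possibly there are none), or its first edge is directed, `a → c`, and all
the other edges (possibly none) are bi-directed. -/
inductive HalfColliderPath (G : MixedGraph V) : V → V → Type _
  | bidirected {a b : V} (w : G.bi.Walk a b) : HalfColliderPath G a b
  | directed {a c b : V} (h : G.dir a c) (w : G.bi.Walk c b) : HalfColliderPath G a b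

/-- The bi-directed portion: all the nodes of the path, except that the tail of an initial directed
edge is not counted (as the first node). -/
def HalfColliderPath.biPortion {G : MixedGraph V} {a b : V} : G.HalfColliderPath a b → Set V
  | .bidirected w => {v | v ∈ w.support}
  | .directed _ w => {v | v ∈ w.support}

/-- A system of half-collider paths from `Sb` to `Se` (in use, `V` is finite). -/
structure HalfColliderSystem (G : MixedGraph V) (Sb Se : Set V) where
  s : ℕ
  card_begin : Sb.ncard = s
  card_end : Se.ncard = s
  first : Fin s → V
  last : Fin s → V
  path : ∀ l, G.HalfColliderPath (first l) (last l)
  first_mem : ∀ l, first l ∈ Sb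
  last_mem : ∀ l, last l ∈ Se
  first_surj : ∀ v ∈ Sb, ∃ l, first l = v
  last_surj : ∀ v ∈ Se, ∃ l, last l = v

/-- The induced subgraph `G_{-i}` contains a system of half-collider paths from a subset of
`V ∖ (pa(i) ∪ {i})` to `sib(i)` such that the bi-directed portions are pairwise disjoint. -/
def HalfColliderCondition (G : MixedGraph V) (i : V) : Prop :=
  ∃ Sb : Set ({i}ᶜ : Set V), (∀ v ∈ Sb, (v : V) ∉ G.pa i ∪ {i}) ∧
    ∃ P : (G.induce {i}ᶜ).HalfColliderSystem Sb {v | (v : V) ∈ G.sib i},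
      Pairwise fun k l => Disjoint (P.path k).biPortion (P.path l).biPortion

end Graph

/-! ### The linear structural equation model and its log-likelihood function -/

section Model

variable {V : Type*} [Fintype V] [DecidableEq V]

/-- The parameter set `𝐁(G)`. -/
def BSet (G : MixedGraph V) : Set (Matrix V V ℝ) :=
  {B | IsUnit (1 - B) ∧ ∀ i j, ¬ G.dir j i → B i j = 0}

/-- The parameter set `𝛀(G)`; `PosDef` includes symmetry. -/
def OmegaSet (G : MixedGraph V) : Set (Matrix V V ℝ) :=
  {Om | Om.PosDef ∧ ∀ i j, i ≠ j → ¬ G.bi.Adj j i → Om i j = 0}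

/-- The log-likelihood function
`-log det((I-B)⁻¹ Ω (I-B)⁻ᵀ) - tr((I-B)ᵀ Ω⁻¹ (I-B) S)` with `S = Y Yᵀ / N`, at `(B, Ω)`. -/
noncomputable def logLik {N : ℕ} (Y : Matrix V (Fin N) ℝ)
    (θ : Matrix V V ℝ × Matrix V V ℝ) : ℝ :=
  - Real.log ((1 - θ.1)⁻¹ * θ.2 * ((1 - θ.1)⁻¹).transpose).det
    - ((1 - θ.1).transpose * θ.2⁻¹ * (1 - θ.1) * ((1 / (N : ℝ)) • (Y * Y.transpose))).trace

/-! ### Block-coordinate descent -/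

/-- The feasible set of the `i`-th block update problem at `θ = (B, Ω)`: pairs
`(B', Ω') ∈ 𝐁(G) × 𝛀(G)` (so `Ω'` is positive definite and `I - B'` invertible) that agree with
`(B, Ω)` off the `i`-th row of `B` and off the `i`-th row and column of `Ω`. -/
def blockFeasible (G : MixedGraph V) (i : V) (θ : Matrix V V ℝ × Matrix V V ℝ) :
    Set (Matrix V V ℝ × Matrix V V ℝ) :=
  {θ' | θ'.1 ∈ G.BSet ∧ θ'.2 ∈ G.OmegaSet ∧ (∀ a b, a ≠ i → θ'.1 a b = θ.1 a b) ∧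
    (∀ a b, a ≠ i → b ≠ i → θ'.2 a b = θ.2 a b)}

/-- `θ'` is a feasible solution of the `i`-th block update problem at `θ`. -/
def IsBlockSolution (G : MixedGraph V) {N : ℕ} (Y : Matrix V (Fin N) ℝ) (i : V)
    (θ θ' : Matrix V V ℝ × Matrix V V ℝ) : Prop :=
  θ' ∈ G.blockFeasible i θ ∧ IsMaxOn (logLik Y) (G.blockFeasible i θ) θ'

/-- Block-coordinate descent for the data `Y`, started at `θ` and visiting successively the nodes
in the list, has a unique and feasible block update at each step. -/
def UniqueFeasibleUpdates (G : MixedGraph V) {N : ℕ} (Y : Matrix V (Fin N) ℝ) :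
    List V → Matrix V V ℝ × Matrix V V ℝ → Prop
  | [], _ => True
  | i :: l, θ => ∃ θ', (G.IsBlockSolution Y i θ θ' ∧ ∀ θ'', G.IsBlockSolution Y i θ θ'' → θ'' = θ') ∧
      UniqueFeasibleUpdates G Y l θ'

/-! ### Generic triples -/

/-- The positions of the free entries of `B`. -/
abbrev DirEdge (G : MixedGraph V) : Type _ := {e : V × V // G.dir e.1 e.2}

/-- The positions of the free entries of `Ω`: the diagonal and the bi-directed edges. -/
abbrev OmegaIndex (G : MixedGraph V) : Type _ := V ⊕ {e : Sym2 V // e ∈ G.bi.edgeSet}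

open scoped Classical in
/-- The matrix `B` with free entries `β`; the coefficient of `j → i` is at position `(i, j)`. -/
noncomputable def toB (G : MixedGraph V) (β : G.DirEdge → ℝ) : Matrix V V ℝ :=
  Matrix.of fun i j => if h : G.dir j i then β ⟨(j, i), h⟩ else 0

open scoped Classical in
/-- The symmetric matrix `Ω` with free entries `ω`. -/
noncomputable def toOmega (G : MixedGraph V) (ω : G.OmegaIndex → ℝ) : Matrix V V ℝ :=
  Matrix.of fun i j => if i = j then ω (Sum.inl i)
    else if h : s(i, j) ∈ G.bi.edgeSet then ω (Sum.inr ⟨s(i, j), h⟩) else 0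

open scoped Classical in
/-- A property of triples `(Y, (B, Ω))` holds for generic triples in `ℝ^{V × N} × 𝐁(G) × 𝛀(G)`:
the exceptional triples form a Lebesgue null set in the coordinates given by the entries of `Y`
and the free entries of `B` and `Ω`. -/
def ForGenericTriples (G : MixedGraph V) (N : ℕ)
    (P : Matrix V (Fin N) ℝ → Matrix V V ℝ × Matrix V V ℝ → Prop) : Prop :=
  ∀ᵐ p : (V → Fin N → ℝ) × (G.DirEdge → ℝ) × (G.OmegaIndex → ℝ),
    G.toB p.2.1 ∈ G.BSet → G.toOmega p.2.2 ∈ G.OmegaSet →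
      P (Matrix.of p.1) (G.toB p.2.1, G.toOmega p.2.2)

end Model

end MixedGraph

/-! Fix `i`. A point of the block is described by a vector `v`, holding the `i`-th row of `1 - B` on
`i` and its parents together with the negated sibling entries of `Ω`, and by the Schur complement
`η` of `Ω` at `i`. In these coordinates (`logLik_blockPoint`) the log-likelihood is a constant plus
`log ((c ⬝ᵥ v)² / η) - (v ⬝ᵥ A v) / (N η)`, where `A` is the Gram matrix of `blockRows * Y` and `c`
collects the cofactors of `1 - B` along row `i`. If `A` is nonsingular, Cauchy–Schwarz and `log x ≤
x - 1` put every maximizer on the line through `A⁻¹ c`, and `v i = 1` selects the point of that line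
unless the coordinate of `A⁻¹ c` at `i` is zero. If the rows of `blockRows` are dependent, a kernel
vector turns any maximizer into a second one (`not_unique_of_vecMul_eq_zero`).

Independence of these rows means that `Ω⁻¹ (1 - B)`, formed on `G_{-i}`, has full row rank on
siblings × nonparents. By a Schur complement a nonzero minor is a nonzero bordered determinant; the
orbits of a permutation in its Leibniz expansion are the required half-collider paths
(`exists_system_of_vecMul`). Conversely, a disjoint system yields matrices with an explicitly
dominant minor (`exists_matrices_of_halfColliderCondition`).

So (b) gives (a) by looking at one feasible generic start. For (a) implies (b), all iterates are
rational in the data and the start, so it is enough that no denominator vanishes at one point. Take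
a feasible `θ₀` that is nondegenerate at all nodes, and data whose sample covariance is the model
covariance of `θ₀`: every update then fixes `θ₀` (`blockUpdate_eq_self`), so nondegeneracy at `θ₀`
settles every number of iterations (`ae_uniqueFeasibleUpdates`). -/

/-! ### Functions that are rational along the lines through a point -/

section RegularAt

variable {E : Type*} [NormedAddCommGroup E] [NormedSpace ℝ E] [MeasurableSpace E]

/-- `f` is measurable and, along every line through `p`, it is given by a rational function whose
denominator does not vanish at `p`, wherever this denominator does not vanish. -/
def RegularAt (p : E) (f : E → ℝ) : Prop :=
  Measurable f ∧ ∀ y : E, ∃ a b : Polynomial ℝ, b.eval 0 ≠ 0 ∧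
    ∀ t : ℝ, b.eval t ≠ 0 → f (p + t • y) = a.eval t / b.eval t

namespace RegularAt

variable {p : E} {f g : E → ℝ}

theorem const (c : ℝ) : RegularAt p fun _ => c :=
  ⟨measurable_const, fun _ => ⟨Polynomial.C c, 1, by simp, by simp⟩⟩

theorem of_continuousLinearMap [BorelSpace E] (L : E →L[ℝ] ℝ) : RegularAt p fun x => L x :=
  ⟨L.continuous.measurable, fun y =>
    ⟨Polynomial.C (L p) + Polynomial.C (L y) * Polynomial.X, 1, by simp, fun t _ => by
      simp only [map_add, map_smul, smul_eq_mul, Polynomial.eval_add, Polynomial.eval_mul,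
        Polynomial.eval_C, Polynomial.eval_X, Polynomial.eval_one, div_one, mul_comm]⟩⟩

theorem add (hf : RegularAt p f) (hg : RegularAt p g) : RegularAt p fun x => f x + g x := by
  refine ⟨hf.1.add hg.1, fun y => ?_⟩
  obtain ⟨a, b, hb, h⟩ := hf.2 y
  obtain ⟨a', b', hb', h'⟩ := hg.2 y
  refine ⟨a * b' + b * a', b * b', by simp [hb, hb'], fun t ht => ?_⟩
  simp only [Polynomial.eval_mul, ne_eq, mul_eq_zero, not_or] at ht
  simp only [h t ht.1, h' t ht.2, div_add_div _ _ ht.1 ht.2,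
    Polynomial.eval_add, Polynomial.eval_mul]

theorem mul (hf : RegularAt p f) (hg : RegularAt p g) : RegularAt p fun x => f x * g x := by
  refine ⟨hf.1.mul hg.1, fun y => ?_⟩
  obtain ⟨a, b, hb, h⟩ := hf.2 y
  obtain ⟨a', b', hb', h'⟩ := hg.2 y
  refine ⟨a * a', b * b', by simp [hb, hb'], fun t ht => ?_⟩
  simp only [Polynomial.eval_mul, ne_eq, mul_eq_zero, not_or] at ht
  simp only [h t ht.1, h' t ht.2, div_mul_div_comm, Polynomial.eval_mul]

theorem inv (hf : RegularAt p f) (h0 : f p ≠ 0) : RegularAt p fun x => (f x)⁻¹ := by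
  refine ⟨hf.1.inv, fun y => ?_⟩
  obtain ⟨a, b, hb, h⟩ := hf.2 y
  have ha : a.eval 0 ≠ 0 := fun ha => h0 (by simpa [ha] using h 0 hb)
  -- The factor `b` is not cancelled: the formula for `f` is only known where `b` does not vanish,
  -- so the new denominator has to vanish with `b`.
  refine ⟨b * b, a * b, by simp [ha, hb], fun t ht => ?_⟩
  simp only [Polynomial.eval_mul, ne_eq, mul_eq_zero, not_or] at ht ⊢
  rw [h t ht.2, inv_div, mul_div_mul_right _ _ ht.2]

theorem neg (hf : RegularAt p f) : RegularAt p fun x => - f x := by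
  simpa using (const (-1)).mul hf

theorem sub (hf : RegularAt p f) (hg : RegularAt p g) : RegularAt p fun x => f x - g x := by
  simpa [sub_eq_add_neg] using hf.add hg.neg

theorem div (hf : RegularAt p f) (hg : RegularAt p g) (h0 : g p ≠ 0) :
    RegularAt p fun x => f x / g x := by
  simpa [div_eq_mul_inv] using hf.mul (hg.inv h0)

theorem sum {ι : Type*} (s : Finset ι) {F : ι → E → ℝ} (h : ∀ i ∈ s, RegularAt p (F i)) :
    RegularAt p fun x => ∑ i ∈ s, F i x := by
  classical
  induction s using Finset.induction_on with
  | empty => simpa using const 0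
  | insert i s hi ih =>
    simp only [Finset.sum_insert hi]
    exact (h i (by simp)).add (ih fun j hj => h j (by simp [hj]))

theorem prod {ι : Type*} (s : Finset ι) {F : ι → E → ℝ} (h : ∀ i ∈ s, RegularAt p (F i)) :
    RegularAt p fun x => ∏ i ∈ s, F i x := by
  classical
  induction s using Finset.induction_on with
  | empty => simpa using const 1
  | insert i s hi ih =>
    simp only [Finset.prod_insert hi]
    exact (h i (by simp)).mul (ih fun j hj => h j (by simp [hj]))

/-- A function which is regular at a point and nonzero there is nonzero almost everywhere. -/
theorem ae_ne_zero [BorelSpace E] [FiniteDimensional ℝ E] (μ : Measure E) [μ.IsAddHaarMeasure]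
    (hf : RegularAt p f) (h0 : f p ≠ 0) : ∀ᵐ x ∂μ, f x ≠ 0 := by
  have hmeas : MeasurableSet {x : E | f (p + x) ≠ 0} :=
    (hf.1.comp (measurable_const_add p)) (measurableSet_singleton 0).compl
  -- On each line through `p` the exceptional parameters are among the roots of `a * b`, which is a
  -- nonzero polynomial because it does not vanish at `0`.
  have key : ∀ x : E, ∀ᵐ t : ℝ, f (p + t • x) ≠ 0 := by
    intro x
    obtain ⟨a, b, hb, h⟩ := hf.2 x
    have ha : a.eval 0 ≠ 0 := fun ha => h0 (by simpa [ha] using h 0 hb)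
    have hab : a * b ≠ 0 := fun h => mul_ne_zero ha hb (by rw [← Polynomial.eval_mul, h]; simp)
    have hfin : {t : ℝ | (a * b).eval t = 0}.Finite :=
      (a * b).roots.toFinset.finite_toSet.subset fun t ht => by
        simpa [hab, -mul_eq_zero] using ht
    refine measure_mono_null (fun t ht => ?_) (hfin.measure_zero volume)
    simp only [Set.mem_compl_iff, Set.mem_ofPred_eq, not_not] at ht
    by_contra hne
    simp only [Polynomial.eval_mul, Set.mem_ofPred_eq, mul_eq_zero, not_or] at hne
    rw [h t hne.2, div_eq_zero_iff] at ht
    tauto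
  -- Fubini: some fixed `t ≠ 0` is good for almost every direction `x`; scaling by `t` and
  -- translating by `p` preserve null sets.
  have hcomm : ∀ᵐ t : ℝ, ∀ᵐ x ∂μ, f (p + t • x) ≠ 0 := by
    refine (Measure.ae_ae_comm ?_).1 (Filter.Eventually.of_forall key)
    have : Measurable fun q : E × ℝ => q.2 • q.1 := by fun_prop
    exact this hmeas
  have hne : ∀ᵐ t : ℝ, t ≠ 0 := by simp [ae_iff]
  obtain ⟨t, ht, ht0⟩ := (hcomm.and hne).exists
  have h1 : μ {x : E | f (p + x) ≠ 0}ᶜ = 0 := by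
    have := Measure.addHaar_preimage_smul μ ht0 {x : E | f (p + x) ≠ 0}ᶜ
    rw [show (t • ·) ⁻¹' {x : E | f (p + x) ≠ 0}ᶜ = {x | f (p + t • x) ≠ 0}ᶜ from rfl] at this
    rw [show μ {x | f (p + t • x) ≠ 0}ᶜ = 0 from ht, eq_comm, mul_eq_zero] at this
    refine this.resolve_left ?_
    simp [ht0]
  have h2 := measure_preimage_add μ (-p) {x : E | f (p + x) ≠ 0}ᶜ
  rw [h1] at h2
  rw [ae_iff]
  convert h2 using 2
  ext x
  simp

end RegularAt

/-- All the entries of a matrix-valued function are regular at `p`. -/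
def MatrixRegularAt {m n : Type*} (p : E) (M : E → Matrix m n ℝ) : Prop :=
  ∀ i j, RegularAt p fun x => M x i j

namespace MatrixRegularAt

variable {l m n : Type*} {p : E}

theorem const (A : Matrix m n ℝ) : MatrixRegularAt p fun _ => A := fun _ _ => RegularAt.const _

theorem sub {M M' : E → Matrix m n ℝ} (h : MatrixRegularAt p M) (h' : MatrixRegularAt p M') :
    MatrixRegularAt p fun x => M x - M' x := fun i j => (h i j).sub (h' i j)

theorem mul [Fintype m] {M : E → Matrix l m ℝ} {M' : E → Matrix m n ℝ} (h : MatrixRegularAt p M)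
    (h' : MatrixRegularAt p M') : MatrixRegularAt p fun x => M x * M' x := fun i j => by
  simp only [Matrix.mul_apply]
  exact RegularAt.sum _ fun k _ => (h i k).mul (h' k j)

theorem transpose {M : E → Matrix m n ℝ} (h : MatrixRegularAt p M) :
    MatrixRegularAt p fun x => (M x).transpose := fun i j => h j i

theorem det [Fintype n] [DecidableEq n] {M : E → Matrix n n ℝ} (h : MatrixRegularAt p M) :
    RegularAt p fun x => (M x).det := by
  simp only [Matrix.det_apply']
  exact RegularAt.sum _ fun σ _ => (RegularAt.const _).mul (RegularAt.prod _ fun i _ => h _ _)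

theorem adjugate [Fintype n] [DecidableEq n] {M : E → Matrix n n ℝ} (h : MatrixRegularAt p M) :
    MatrixRegularAt p fun x => (M x).adjugate := fun i j => by
  simp only [Matrix.adjugate_apply]
  refine det fun k l => ?_
  by_cases hk : k = j
  · subst hk; simpa using RegularAt.const _
  · simpa [hk] using h k l

theorem inv [Fintype n] [DecidableEq n] {M : E → Matrix n n ℝ} (h : MatrixRegularAt p M)
    (h0 : (M p).det ≠ 0) : MatrixRegularAt p fun x => (M x)⁻¹ := fun i j => by
  simp only [Matrix.inv_def, Ring.inverse_eq_inv', Matrix.smul_apply, smul_eq_mul]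
  exact (h.det.inv h0).mul (h.adjugate i j)

end MatrixRegularAt

end RegularAt

/-! ### From nonvanishing determinants to systems of half-collider paths -/

namespace Matrix

/-- A matrix with linearly independent rows has a nonsingular square submatrix on all rows. -/
theorem exists_injective_det_submatrix_ne_zero {m n : Type*} [Fintype m] [DecidableEq m]
    [Fintype n] (R : Matrix m n ℝ) (hR : ∀ y : m → ℝ, y ᵥ* R = 0 → y = 0) :
    ∃ a : m → n, Function.Injective a ∧ (R.submatrix id a).det ≠ 0 := by
  have hrow : LinearIndependent ℝ R.row := by
    rw [← Matrix.vecMul_injective_iff]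
    exact (injective_iff_map_eq_zero R.vecMulLinear).2 hR
  -- Choose a basis among the columns; row rank equals column rank, so it has as many members as
  -- there are rows.
  obtain ⟨κ, a, ha, hspan, hli⟩ := exists_linearIndependent' ℝ R.col
  have : Finite κ := hli.finite
  have := Fintype.ofFinite κ
  have hcard : Fintype.card κ = Fintype.card m := by
    rw [← finrank_span_eq_card hli, hspan, ← hrow.rank_matrix, Matrix.rank_eq_finrank_span_cols]
  let e : m ≃ κ := Fintype.equivOfCardEq hcard.symm
  refine ⟨a ∘ e, ha.comp e.injective, ?_⟩
  rw [← isUnit_iff_ne_zero, ← Matrix.isUnit_iff_isUnit_det,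
    ← Matrix.linearIndependent_cols_iff_isUnit]
  exact hli.comp e e.injective

/-- Some term of the Leibniz expansion is nonzero. -/
theorem exists_perm_of_det_ne_zero {n : Type*} [Fintype n] [DecidableEq n] {M : Matrix n n ℝ}
    (h : M.det ≠ 0) : ∃ π : Equiv.Perm n, ∀ x, M x (π x) ≠ 0 := by
  rw [← Matrix.det_transpose, Matrix.det_apply] at h
  obtain ⟨σ, -, hσ⟩ := Finset.exists_ne_zero_of_sum_ne_zero h
  refine ⟨σ, fun x hx => hσ ?_⟩
  rw [Finset.prod_eq_zero (Finset.mem_univ x) (by simpa using hx), smul_zero]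

end Matrix

namespace MixedGraph

variable {W : Type*}

section Orbit

variable {s : ℕ} (π : Equiv.Perm (W ⊕ Fin s))

theorem exists_pow_succ_eq_inr [Finite W] (l : Fin s) :
    ∃ n, ∃ m, (π ^ (n + 1)) (Sum.inr l) = Sum.inr m := by
  obtain ⟨n, hn, h⟩ := (isOfFinOrder_of_finite π).exists_pow_eq_one
  refine ⟨n - 1, l, ?_⟩
  rw [Nat.sub_add_cancel hn, h]
  rfl

open scoped Classical in
/-- One less than the first time at which the orbit of `l` returns to the right summand. -/
noncomputable def returnTime [Finite W] (l : Fin s) : ℕ := Nat.find (exists_pow_succ_eq_inr π l)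

open scoped Classical in
theorem returnTime_spec [Finite W] (l : Fin s) :
    ∃ m, (π ^ (returnTime π l + 1)) (Sum.inr l) = Sum.inr m :=
  Nat.find_spec (exists_pow_succ_eq_inr π l)

open scoped Classical in
theorem ne_inr_of_lt_returnTime [Finite W] {l m : Fin s} {k : ℕ} (hk : k < returnTime π l) :
    (π ^ (k + 1)) (Sum.inr l) ≠ Sum.inr m :=
  fun h => Nat.find_min (exists_pow_succ_eq_inr π l) hk ⟨m, h⟩

/-- The orbits up to their first return are disjoint. -/
theorem eq_of_pow_eq_pow [Finite W] {l m : Fin s} {j k : ℕ} (hj : j ≤ returnTime π l)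
    (hk : k ≤ returnTime π m) (h : (π ^ (j + 1)) (Sum.inr l) = (π ^ (k + 1)) (Sum.inr m)) :
    l = m := by
  wlog hjk : j ≤ k generalizing j k l m
  · exact (this hk hj h.symm (le_of_not_ge hjk)).symm
  obtain ⟨d, rfl⟩ := Nat.exists_eq_add_of_le hjk
  rw [show j + d + 1 = (j + 1) + d by ring, pow_add π (j + 1) d, Equiv.Perm.mul_apply] at h
  have h' := (π ^ (j + 1)).injective h
  rcases d with _ | d
  · simpa using h'
  · exact absurd h'.symm (ne_inr_of_lt_returnTime π (by omega))

variable (H : MixedGraph W) {b : Fin s → W}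

/-- The orbit of `l` enters the left summand at `b l` and then moves along bi-directed edges or
stays put. It is read backwards, as a walk ending at `b l`, because the orbit starts at the last
node of the path. -/
theorem exists_walk_of_pow_eq (h1 : ∀ l, π (Sum.inr l) = Sum.inl (b l))
    (h2 : ∀ w w', π (Sum.inl w) = Sum.inl w' → w = w' ∨ H.bi.Adj w w') (l : Fin s) (n : ℕ)
    (hn : ∀ k < n, ∀ m, (π ^ (k + 1)) (Sum.inr l) ≠ Sum.inr m) (v : W)
    (hv : (π ^ (n + 1)) (Sum.inr l) = Sum.inl v) :
    ∃ p : H.bi.Walk v (b l), ∀ x ∈ p.support, ∃ k ≤ n, (π ^ (k + 1)) (Sum.inr l) = Sum.inl x := by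
  induction n generalizing v with
  | zero =>
    obtain rfl : b l = v := by simpa [h1] using hv
    exact ⟨.nil, fun x hx => ⟨0, le_rfl, by simp_all⟩⟩
  | succ n ih =>
    rcases hu : (π ^ (n + 1)) (Sum.inr l) with u | m
    · obtain ⟨p, hp⟩ := ih (fun k hk => hn k (by omega)) u hu
      have hlift : ∀ x ∈ p.support, ∃ k ≤ n + 1, (π ^ (k + 1)) (Sum.inr l) = Sum.inl x :=
        fun x hx => (hp x hx).imp fun k hk => ⟨by omega, hk.2⟩
      rw [pow_succ', Equiv.Perm.mul_apply, hu] at hv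
      rcases h2 u v hv with rfl | hadj
      · exact ⟨p, hlift⟩
      · refine ⟨.cons hadj.symm p, fun x hx => ?_⟩
        rw [SimpleGraph.Walk.support_cons, List.mem_cons] at hx
        rcases hx with rfl | hx
        · exact ⟨n + 1, le_rfl, by rw [pow_succ', Equiv.Perm.mul_apply, hu, hv]⟩
        · exact hlift x hx
    · exact absurd hu (hn n (by omega) m)

/-- The first-return segments of the orbits of a permutation whose steps follow the edges of a mixed
graph form a system of half-collider paths with disjoint bi-directed portions. -/
theorem exists_system_of_perm [Finite W] {a : Fin s → W} (ha : Function.Injective a)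
    (hb : Function.Injective b) (h1 : ∀ l, π (Sum.inr l) = Sum.inl (b l))
    (h2 : ∀ w w', π (Sum.inl w) = Sum.inl w' → w = w' ∨ H.bi.Adj w w')
    (h3 : ∀ w m, π (Sum.inl w) = Sum.inr m → w = a m ∨ H.dir (a m) w) :
    ∃ P : H.HalfColliderSystem (Set.range a) (Set.range b),
      Pairwise fun k l => Disjoint (P.path k).biPortion (P.path l).biPortion := by
  -- `r l` is the index where the orbit of `l` first returns. Disjointness of the orbit segments
  -- makes `r` a bijection, which matches starting nodes with end nodes.
  choose r hr using returnTime_spec π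
  have hr_inj : Function.Injective r := fun l m h =>
    eq_of_pow_eq_pow π le_rfl le_rfl (by rw [hr, hr, h])
  have hr_surj : Function.Surjective r := Finite.surjective_of_injective hr_inj
  have hpath : ∀ l, ∃ p : H.HalfColliderPath (a (r l)) (b l), ∀ x ∈ p.biPortion,
      ∃ k ≤ returnTime π l, (π ^ (k + 1)) (Sum.inr l) = Sum.inl x := by
    intro l
    have hpos : returnTime π l ≠ 0 := fun h => by
      have := hr l
      rw [h, zero_add, pow_one, h1] at this
      cases this
    obtain ⟨n, hn⟩ := Nat.exists_eq_succ_of_ne_zero hpos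
    rcases hu : (π ^ (n + 1)) (Sum.inr l) with u | m
    · obtain ⟨p, hp⟩ := exists_walk_of_pow_eq π H h1 h2 l n
        (fun k hk m => ne_inr_of_lt_returnTime π (by omega)) u hu
      have hlift : ∀ x ∈ p.support, ∃ k ≤ returnTime π l, (π ^ (k + 1)) (Sum.inr l) = Sum.inl x :=
        fun x hx => (hp x hx).imp fun k hk => ⟨by omega, hk.2⟩
      have hlast := hr l
      rw [hn, Nat.succ_eq_add_one, pow_succ', Equiv.Perm.mul_apply, hu] at hlast
      -- The step that returns to the right summand decides whether the path starts at `u` itself or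
      -- with a directed edge into `u`.
      rcases h3 u _ hlast with rfl | hdir
      · exact ⟨.bidirected p, hlift⟩
      · exact ⟨.directed hdir p, hlift⟩
    · exact absurd hu (ne_inr_of_lt_returnTime π (by omega))
  choose p hp using hpath
  refine ⟨⟨s, ?_, ?_, a ∘ r, b, p, fun l => ⟨_, rfl⟩, fun l => ⟨_, rfl⟩, ?_, ?_⟩, ?_⟩
  · rw [← Set.image_univ, Set.ncard_image_of_injective _ ha, Set.ncard_univ, Nat.card_fin]
  · rw [← Set.image_univ, Set.ncard_image_of_injective _ hb, Set.ncard_univ, Nat.card_fin]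
  · rintro _ ⟨m, rfl⟩
    obtain ⟨l, rfl⟩ := hr_surj m
    exact ⟨l, rfl⟩
  · rintro _ ⟨l, rfl⟩
    exact ⟨l, rfl⟩
  · intro k l hkl
    rw [Set.disjoint_left]
    intro x hx hx'
    obtain ⟨j, hj, h⟩ := hp k x hx
    obtain ⟨j', hj', h'⟩ := hp l x hx'
    exact hkl (eq_of_pow_eq_pow π hj hj' (h.trans h'.symm))

end Orbit

/-- If the rows of the `D × C` submatrix of `Ω⁻¹ K` are linearly independent, there is a system of
half-collider paths from a subset of `C` to `D` with disjoint bi-directed portions. -/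
theorem exists_system_of_vecMul [Fintype W] [DecidableEq W] (H : MixedGraph W) (D C : Set W)
    {K Om : Matrix W W ℝ} (hOm : IsUnit Om.det)
    (hOms : ∀ u v, u ≠ v → ¬ H.bi.Adj u v → Om u v = 0)
    (hK : ∀ u v, u ≠ v → ¬ H.dir v u → K u v = 0)
    (hz : ∀ z : W → ℝ, (∀ b, b ∉ D → (Matrix.vecMul z Om) b = 0) →
      (∀ c ∈ C, (Matrix.vecMul z K) c = 0) → z = 0) :
    ∃ Sb : Set W, Sb ⊆ C ∧ ∃ P : H.HalfColliderSystem Sb D,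
      Pairwise fun k l => Disjoint (P.path k).biPortion (P.path l).biPortion := by
  classical
  obtain ⟨e⟩ : Nonempty (Fin D.ncard ≃ D) := by
    rw [← Nat.card_coe_set_eq]
    exact ⟨(Finite.equivFin D).symm⟩
  let b : Fin D.ncard → W := fun l => e l
  have hb : Function.Injective b := Subtype.val_injective.comp e.injective
  have hbD : Set.range b = D := by
    ext x
    constructor
    · rintro ⟨l, rfl⟩
      exact (e l).2
    · exact fun hx => ⟨e.symm ⟨x, hx⟩, by simp [b]⟩
  let Q : Matrix (Fin D.ncard) W ℝ := Matrix.of fun l w => if w = b l then 1 else 0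
  have hyQ : ∀ (y : Fin D.ncard → ℝ) w, (Matrix.vecMul y Q) w = ∑ l, if w = b l then y l else 0 :=
    fun y w => by simp [Matrix.vecMul, dotProduct, Q]
  -- `Q` selects the rows in `D`. If `y` annihilates the rows of `Q * Om⁻¹ * K` on `C`, then `z = y
  -- Q Om⁻¹` satisfies both conditions of `hz`, since `z Om = y Q` is supported on `D`.
  obtain ⟨a, ha, hdet⟩ := Matrix.exists_injective_det_submatrix_ne_zero
    ((Q * Om⁻¹ * K).submatrix id (Subtype.val : C → W)) (by
      intro y hy
      have h0 := hz (Matrix.vecMul (Matrix.vecMul y Q) Om⁻¹) (fun w hw => by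
          rw [Matrix.vecMul_vecMul, Matrix.nonsing_inv_mul _ hOm, Matrix.vecMul_one, hyQ]
          refine Finset.sum_eq_zero fun l _ => if_neg ?_
          rintro rfl
          exact hw (hbD ▸ ⟨l, rfl⟩)) (fun c hc => by
          rw [Matrix.vecMul_vecMul, Matrix.vecMul_vecMul, ← Matrix.mul_assoc]
          exact congrFun hy ⟨c, hc⟩)
      have h1 : Matrix.vecMul y Q = 0 := by
        have := congrArg (fun z => Matrix.vecMul z Om) h0
        simpa [Matrix.vecMul_vecMul, Matrix.mul_assoc, Matrix.nonsing_inv_mul _ hOm] using this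
      ext l
      have := congrFun h1 (b l)
      simpa [hyQ, hb.eq_iff] using this)
  let a' : Fin D.ncard → W := fun m => a m
  -- Up to the unit `det Om` and a sign, this determinant is the chosen minor of the Schur
  -- complement. The zero block and the 0-1 rows of `Q` force every permutation with nonzero term to
  -- send `l` to `b l`.
  have hM : (Matrix.fromBlocks Om (K.submatrix id a') Q 0).det ≠ 0 := by
    have := Matrix.invertibleOfIsUnitDet Om hOm
    rw [Matrix.det_fromBlocks₁₁, zero_sub, Matrix.det_neg]
    refine mul_ne_zero hOm.ne_zero (mul_ne_zero (by simp) ?_)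
    convert hdet using 2
    rw [Matrix.invOf_eq_nonsing_inv]
    ext l m
    simp [Matrix.mul_apply, a']
  obtain ⟨π, hπ⟩ := Matrix.exists_perm_of_det_ne_zero hM
  have h1 : ∀ l, π (Sum.inr l) = Sum.inl (b l) := by
    intro l
    have := hπ (Sum.inr l)
    rcases h : π (Sum.inr l) with w | m
    · rw [h] at this
      simp only [Matrix.fromBlocks_apply₂₁, Q, Matrix.of_apply, ne_eq, ite_eq_right_iff,
        Classical.not_imp] at this
      rw [this.1]
    · simp [h] at this
  have h2 : ∀ w w', π (Sum.inl w) = Sum.inl w' → w = w' ∨ H.bi.Adj w w' := by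
    intro w w' h
    have := hπ (Sum.inl w)
    rw [h, Matrix.fromBlocks_apply₁₁] at this
    by_contra hne
    rw [not_or] at hne
    exact this (hOms w w' hne.1 hne.2)
  have h3 : ∀ w m, π (Sum.inl w) = Sum.inr m → w = a' m ∨ H.dir (a' m) w := by
    intro w m h
    have := hπ (Sum.inl w)
    rw [h, Matrix.fromBlocks_apply₁₂] at this
    by_contra hne
    rw [not_or] at hne
    exact this (hK _ _ hne.1 hne.2)
  have hfin := exists_system_of_perm π H (Subtype.val_injective.comp ha) hb h1 h2 h3
  rw [hbD] at hfin
  refine ⟨Set.range a', ?_, hfin⟩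
  rintro _ ⟨m, rfl⟩
  exact (a m).2

end MixedGraph

/-! ### From systems of half-collider paths to nonvanishing determinants -/

namespace Matrix

variable {V : Type*} [Fintype V] [DecidableEq V]

section Neumann

attribute [local instance] Matrix.linftyOpNormedRing Matrix.linftyOpNormedAlgebra

/-- For small `t`, the inverse of `1 - t A` is the Neumann series. -/
theorem exists_inv_one_sub_smul_eq (A : Matrix V V ℝ) : ∃ t : ℝ, 0 < t ∧
    IsUnit (1 - t • A).det ∧ ∀ u v, HasSum (fun n => t ^ n * (A ^ n) u v) ((1 - t • A)⁻¹ u v) := by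
  refine ⟨(‖A‖ + 1)⁻¹, by positivity, ?_⟩
  set t := (‖A‖ + 1)⁻¹ with ht
  have hlt : ‖t • A‖ < 1 := by
    rw [norm_smul, ht, Real.norm_of_nonneg (by positivity), inv_mul_lt_one₀ (by positivity)]
    linarith
  have hs := summable_geometric_of_norm_lt_one hlt
  have hmul := geom_series_mul_neg (t • A) hlt
  have hinv : (1 - t • A)⁻¹ = ∑' n, (t • A) ^ n := Matrix.inv_eq_left_inv hmul
  refine ⟨Matrix.isUnit_det_of_left_inverse hmul, fun u v => ?_⟩
  rw [hinv]
  have := Pi.hasSum.1 (Pi.hasSum.1 hs.hasSum u) v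
  simp only [smul_pow, Matrix.smul_apply, smul_eq_mul] at this ⊢
  exact this

end Neumann

end Matrix

namespace MixedGraph

section Chain

variable {V ι : Type*} (G : MixedGraph V) (S : ι → Set V)

open scoped Classical in
/-- The adjacency matrix of the bi-directed edges with both ends in the same one of the sets. -/
noncomputable def chainMatrix : Matrix V V ℝ :=
  Matrix.of fun u v => if ∃ l, u ∈ S l ∧ v ∈ S l ∧ G.bi.Adj u v then 1 else 0

theorem chainMatrix_nonneg (u v : V) : 0 ≤ G.chainMatrix S u v := by
  simp only [chainMatrix, Matrix.of_apply]
  split_ifs <;> norm_num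

variable [Fintype V] [DecidableEq V]

theorem chainMatrix_pow_nonneg (n : ℕ) (u v : V) : 0 ≤ (G.chainMatrix S ^ n) u v := by
  induction n generalizing u v with
  | zero => rw [pow_zero, Matrix.one_apply]; split_ifs <;> norm_num
  | succ n ih =>
    rw [pow_succ, Matrix.mul_apply]
    exact Finset.sum_nonneg fun w _ => mul_nonneg (ih u w) (G.chainMatrix_nonneg S w v)

variable {S}

/-- Each edge counted by the matrix stays inside one set; as the sets are disjoint, no product of
such edges can leave `S l`. -/
theorem mem_of_chainMatrix_pow_ne_zero (hS : Pairwise fun k l => Disjoint (S k) (S l)) {l : ι}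
    {u v : V} (hu : u ∈ S l) (n : ℕ) (h : (G.chainMatrix S ^ n) u v ≠ 0) : v ∈ S l := by
  induction n generalizing v with
  | zero =>
    rw [pow_zero, Matrix.one_apply] at h
    split_ifs at h with huv
    · exact huv ▸ hu
    · exact absurd rfl h
  | succ n ih =>
    rw [pow_succ, Matrix.mul_apply] at h
    obtain ⟨w, -, hw⟩ := Finset.exists_ne_zero_of_sum_ne_zero h
    have hwl := ih (left_ne_zero_of_mul hw)
    have hwv := right_ne_zero_of_mul hw
    simp only [chainMatrix, Matrix.of_apply, ne_eq, ite_eq_right_iff, one_ne_zero, imp_false,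
      not_not] at hwv
    obtain ⟨k, hk, hvk, -⟩ := hwv
    obtain rfl : k = l := by
      by_contra hkl
      exact Set.disjoint_left.1 (hS hkl) hk hwl
    exact hvk

/-- Powers of an adjacency matrix count walks. The indices are reversed because the walk grows at
its first node. -/
theorem exists_chainMatrix_pow_pos {X : Set V} {l : ι} {a b : X} (w : (G.bi.induce X).Walk a b)
    (hw : ∀ x ∈ w.support, (x : V) ∈ S l) : ∃ n, 0 < (G.chainMatrix S ^ n) b a := by
  induction w with
  | nil => exact ⟨0, by simp⟩
  | @cons u v b h p ih =>
    obtain ⟨n, hn⟩ := ih fun x hx => hw x (by simp [hx])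
    refine ⟨n + 1, ?_⟩
    rw [pow_succ, Matrix.mul_apply]
    refine lt_of_lt_of_le ?_ (Finset.single_le_sum (f := fun j : V =>
      (G.chainMatrix S ^ n) b j * G.chainMatrix S j u) (fun j _ => mul_nonneg
        (G.chainMatrix_pow_nonneg S n _ _) (G.chainMatrix_nonneg S _ _)) (Finset.mem_univ (v : V)))
    refine mul_pos hn ?_
    have : ∃ l, (v : V) ∈ S l ∧ (u : V) ∈ S l ∧ G.bi.Adj v u :=
      ⟨l, hw _ (by simp), hw _ (by simp), SimpleGraph.Adj.symm (G := G.bi) h⟩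
    simp [chainMatrix, this]

end Chain

/-- A uniform treatment of the two kinds of path: `c` is the first node of the bi-directed portion,
and it differs from `a` only if there is an initial directed edge. -/
theorem HalfColliderPath.exists_walk {W : Type*} {H : MixedGraph W} {a b : W}
    (p : H.HalfColliderPath a b) : ∃ (c : W) (w : H.bi.Walk c b),
      p.biPortion = {v | v ∈ w.support} ∧ (c ≠ a → H.dir a c) := by
  cases p with
  | bidirected w => exact ⟨_, w, rfl, fun h => absurd rfl h⟩
  | directed h w => exact ⟨_, w, rfl, fun _ => h⟩

/-- A map from `s` indices onto a set of `s` nodes is injective. -/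
theorem HalfColliderSystem.first_injective {W : Type*} {H : MixedGraph W} {Sb Se : Set W}
    (P : H.HalfColliderSystem Sb Se) : Function.Injective P.first := by
  have hS : Sb = Set.range P.first := by
    ext x
    exact ⟨fun hx => P.first_surj x hx, by rintro ⟨l, rfl⟩; exact P.first_mem l⟩
  have hc : (P.first '' Set.univ).ncard = P.s := by
    rw [Set.image_univ, ← hS]
    exact P.card_begin
  rw [← Set.injOn_univ]
  exact Set.injOn_of_ncard_image_eq (by rw [hc, Set.ncard_univ, Nat.card_fin])

theorem HalfColliderSystem.last_injective {W : Type*} {H : MixedGraph W} {Sb Se : Set W}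
    (P : H.HalfColliderSystem Sb Se) : Function.Injective P.last := by
  have hS : Se = Set.range P.last := by
    ext x
    exact ⟨fun hx => P.last_surj x hx, by rintro ⟨l, rfl⟩; exact P.last_mem l⟩
  have hc : (P.last '' Set.univ).ncard = P.s := by
    rw [Set.image_univ, ← hS]
    exact P.card_end
  rw [← Set.injOn_univ]
  exact Set.injOn_of_ncard_image_eq (by rw [hc, Set.ncard_univ, Nat.card_fin])

/-- Under the half-collider condition at `i` there are matrices `B` and `Ω` for the graph, with the
node `i` isolated in `Ω`, such that the rows of `Ω⁻¹ (1 - B)` at the siblings of `i` are linearly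
independent when restricted to the nodes that are neither `i` nor a parent of `i`. -/
theorem exists_matrices_of_halfColliderCondition {V : Type*} [Fintype V] [DecidableEq V]
    (G : MixedGraph V) (i : V) (hG : G.HalfColliderCondition i) :
    ∃ B Om : Matrix V V ℝ, (∀ u v, ¬ G.dir v u → B u v = 0) ∧ Om.IsSymm ∧
      (∀ u v, u ≠ v → ¬ G.bi.Adj v u → Om u v = 0) ∧ (∀ u, u ≠ i → Om i u = 0) ∧ Om i i = 1 ∧
      Om.det ≠ 0 ∧ ∀ y : V → ℝ, (∀ v, ¬ G.bi.Adj v i → y v = 0) →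
        (∀ c, c ≠ i → ¬ G.dir c i → (Matrix.vecMul y (Om⁻¹ * (1 - B))) c = 0) → y = 0 := by
  classical
  obtain ⟨Sb, hSb, P, hP⟩ := hG
  choose c w hw hc using fun l => (P.path l).exists_walk
  let S : Fin P.s → Set V := fun l => Subtype.val '' (P.path l).biPortion
  let f : Fin P.s → V := fun l => P.first l
  let e : Fin P.s → V := fun l => P.last l
  let d : Fin P.s → V := fun l => c l
  have hf : Function.Injective f := Subtype.val_injective.comp P.first_injective
  have he : Function.Injective e := Subtype.val_injective.comp P.last_injective
  have hS : Pairwise fun k l => Disjoint (S k) (S l) := fun k l hkl =>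
    (Set.disjoint_image_iff Subtype.val_injective).2 (hP hkl)
  have hmemS : ∀ l, ∀ x ∈ (w l).support, (x : V) ∈ S l := fun l x hx =>
    ⟨x, by rw [hw]; exact hx, rfl⟩
  have hiS : ∀ l, i ∉ S l := by
    rintro l ⟨x, -, hx⟩
    exact x.2 hx
  obtain ⟨t, ht, hunit, hsum⟩ := Matrix.exists_inv_one_sub_smul_eq (G.chainMatrix S)
  -- By the Neumann series, `Om⁻¹` is supported within the disjoint portions and positive between
  -- the two ends of each: the minor on rows `e` and columns `d` is diagonal with positive diagonal.
  set Om : Matrix V V ℝ := 1 - t • G.chainMatrix S with hOm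
  have hdpos : ∀ l, 0 < Om⁻¹ (e l) (d l) := by
    intro l
    obtain ⟨n, hn⟩ := G.exists_chainMatrix_pow_pos (w l) (hmemS l)
    exact lt_of_lt_of_le (mul_pos (pow_pos ht n) hn) (le_hasSum (hsum (e l) (d l)) n fun k _ =>
      mul_nonneg (pow_pos ht k).le (G.chainMatrix_pow_nonneg S k _ _))
  have hdzero : ∀ l m, l ≠ m → Om⁻¹ (e l) (d m) = 0 := by
    intro l m hlm
    refine (hsum (e l) (d m)).unique ?_
    convert hasSum_zero with n
    refine mul_eq_zero_of_right _ ?_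
    by_contra hne
    have := G.mem_of_chainMatrix_pow_ne_zero hS (hmemS l _ (w l).end_mem_support) n hne
    exact Set.disjoint_left.1 (hS hlm) this (hmemS m _ (w m).start_mem_support)
  -- One weight for all columns: summing over `m` bounds every single quotient, and the `+ 1` makes
  -- the inequality strict.
  let lam : ℝ := ∑ m, (∑ l, |Om⁻¹ (e l) (f m)| + 1) / Om⁻¹ (e m) (d m)
  have hlam : ∀ m, ∑ l, |Om⁻¹ (e l) (f m)| < lam * Om⁻¹ (e m) (d m) := by
    intro m
    rw [← div_lt_iff₀ (hdpos m)]
    refine lt_of_lt_of_le ?_ (Finset.single_le_sum (f := fun m =>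
      (∑ l, |Om⁻¹ (e l) (f m)| + 1) / Om⁻¹ (e m) (d m)) (fun k _ => div_nonneg
        (add_nonneg (Finset.sum_nonneg fun _ _ => abs_nonneg _) zero_le_one) (hdpos k).le)
        (Finset.mem_univ m))
    exact div_lt_div_of_pos_right (lt_add_one _) (hdpos m)
  -- The weight sits on the initial directed edges. It adds `lam` times column `d m` of `Om⁻¹` to
  -- column `f m`, so the minor on rows `e` and columns `f` is strictly dominated by its diagonal,
  -- column by column.
  let B : Matrix V V ℝ := Matrix.of fun u v =>
    if ∃ m, u = d m ∧ v = f m ∧ d m ≠ f m then -lam else 0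
  have hRB : ∀ l m, (Om⁻¹ * (1 - B)) (e l) (f m) =
      Om⁻¹ (e l) (f m) + if d m ≠ f m then lam * Om⁻¹ (e l) (d m) else 0 := by
    intro l m
    rw [mul_sub, mul_one, Matrix.sub_apply, Matrix.mul_apply, sub_eq_add_neg, ← Finset.sum_neg_distrib]
    congr 1
    rw [Finset.sum_eq_single (d m)]
    · split_ifs with h
      · have : ∃ m', d m = d m' ∧ f m = f m' ∧ d m' ≠ f m' := ⟨m, rfl, rfl, h⟩
        simp only [B, Matrix.of_apply, if_pos this]
        ring
      · have : ¬ ∃ m', d m = d m' ∧ f m = f m' ∧ d m' ≠ f m' := by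
          rintro ⟨m', -, h2, h3⟩
          exact h (hf h2 ▸ h3)
        simp only [B, Matrix.of_apply, if_neg this]
        ring
    · intro u _ hu
      have : ¬ ∃ m', u = d m' ∧ f m = f m' ∧ d m' ≠ f m' := by
        rintro ⟨m', h1, h2, -⟩
        exact hu (hf h2 ▸ h1)
      simp only [B, Matrix.of_apply, if_neg this]
      ring
    · simp
  have hdet : (Matrix.of fun l m => (Om⁻¹ * (1 - B)) (e l) (f m)).det ≠ 0 := by
    refine det_ne_zero_of_sum_col_lt_diag fun m => ?_
    simp only [Matrix.of_apply, hRB, Real.norm_eq_abs]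
    by_cases hm : d m = f m
    · simp only [hm, ne_eq, not_true_eq_false, if_false, add_zero]
      rw [Finset.sum_eq_zero]
      · rw [← hm]; exact abs_pos.2 (hdpos m).ne'
      · intro l hl
        rw [← hm, hdzero l m (Finset.ne_of_mem_erase hl), abs_zero]
    · simp only [ne_eq, hm, not_false_eq_true, if_true]
      have h1 := hlam m
      rw [← Finset.sum_erase_add _ _ (Finset.mem_univ m)] at h1
      have h2 : ∑ l ∈ Finset.univ.erase m, |Om⁻¹ (e l) (f m) + lam * Om⁻¹ (e l) (d m)| =
          ∑ l ∈ Finset.univ.erase m, |Om⁻¹ (e l) (f m)| := Finset.sum_congr rfl fun l hl => by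
        rw [hdzero l m (Finset.ne_of_mem_erase hl), mul_zero, add_zero]
      rw [h2]
      have h3 := neg_abs_le (Om⁻¹ (e m) (f m))
      have h4 := le_abs_self (Om⁻¹ (e m) (f m) + lam * Om⁻¹ (e m) (d m))
      linarith
  refine ⟨B, Om, ?_, ?_, ?_, ?_, ?_, hunit.ne_zero, ?_⟩
  · intro u v huv
    refine if_neg ?_
    rintro ⟨m, rfl, rfl, hne⟩
    exact huv (hc m fun h => hne (congrArg Subtype.val h))
  · refine Matrix.IsSymm.ext fun u v => ?_
    simp only [hOm, Matrix.sub_apply, Matrix.smul_apply, chainMatrix, Matrix.of_apply,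
      Matrix.one_apply, eq_comm, G.bi.adj_comm u v, and_left_comm]
  · intro u v huv hadj
    have : ¬ ∃ l, u ∈ S l ∧ v ∈ S l ∧ G.bi.Adj u v := fun ⟨l, _, _, h⟩ => hadj h.symm
    simp [hOm, chainMatrix, this, huv]
  · intro u hu
    simp [hOm, chainMatrix, hiS, hu.symm]
  · simp [hOm, chainMatrix, hiS]
  · intro y hy hyc
    have hrange : ∀ v, (∀ l, e l ≠ v) → y v = 0 := by
      intro v hv
      refine hy v fun hadj => ?_
      have hvi : v ∈ ({i}ᶜ : Set V) := hadj.ne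
      obtain ⟨l, hl⟩ := P.last_surj ⟨v, hvi⟩ hadj
      exact hv l (congrArg Subtype.val hl)
    have hker : Matrix.vecMul (y ∘ e) (Matrix.of fun l m => (Om⁻¹ * (1 - B)) (e l) (f m)) = 0 := by
      ext m
      have hm := hyc (f m) (P.first m).2 fun h => hSb _ (P.first_mem m) (Or.inl h)
      rw [Pi.zero_apply, ← hm]
      simp only [Matrix.vecMul, dotProduct, Function.comp_apply, Matrix.of_apply]
      refine Fintype.sum_of_injective e he _ _ (fun v hv => ?_) fun l => rfl
      rw [hrange v fun l hl => hv ⟨l, hl⟩, zero_mul]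
    have hye := Matrix.eq_zero_of_vecMul_eq_zero hdet hker
    ext v
    by_cases hv : ∃ l, e l = v
    · obtain ⟨l, rfl⟩ := hv
      exact congrFun hye l
    · exact hrange v (by simpa using hv)

end MixedGraph

/-! ### Matrices with a prescribed row and column -/

namespace Matrix

section

variable {V : Type*} [DecidableEq V]

theorem updateRow_one_sub (B : Matrix V V ℝ) (i : V) (r : V → ℝ) :
    1 - B.updateRow i (Pi.single i 1 - r) = (1 - B).updateRow i r := by
  ext a b
  by_cases ha : a = i
  · subst ha
    simp [one_apply, Pi.single_apply, eq_comm]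
  · simp [ha]

/-- Replace the `i`-th row and column by `w`, and the diagonal entry at `i` by `d`. -/
def border (Om : Matrix V V ℝ) (i : V) (w : V → ℝ) (d : ℝ) : Matrix V V ℝ :=
  of fun a b => if a = i then (if b = i then d else w b) else if b = i then w a else Om a b

variable (Om : Matrix V V ℝ) (i : V)

theorem border_isSymm {Om : Matrix V V ℝ} (h : Om.IsSymm) (w : V → ℝ) (d : ℝ) :
    (border Om i w d).IsSymm := by
  refine IsSymm.ext fun a b => ?_
  simp only [border, of_apply]
  split_ifs <;> simp_all [h.apply]

theorem border_zero_eq_updateRow (d : ℝ) :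
    border Om i 0 d = (border Om i 0 1).updateRow i (d • Pi.single i 1) := by
  ext a b
  by_cases ha : a = i
  · subst ha
    simp [border, Pi.single_apply]
  · simp [border, ha]

theorem border_zero_eq_add (d : ℝ) : border Om i 0 d =
    border Om i 0 1 + (d - 1) • vecMulVec (Pi.single i 1) (Pi.single i 1) := by
  ext a b
  by_cases ha : a = i <;> by_cases hb : b = i <;> simp [border, vecMulVec_apply, ha, hb]

end

variable {V : Type*} [Fintype V] [DecidableEq V]

theorem det_updateRow_eq_dotProduct (A : Matrix V V ℝ) (i : V) (r : V → ℝ) :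
    (A.updateRow i r).det = r ⬝ᵥ fun j => A.adjugate j i := by
  rw [det_eq_sum_mul_adjugate_row _ i]
  simp [dotProduct, adjugate_apply]

variable (Om : Matrix V V ℝ) (i : V)

theorem det_border_zero (d : ℝ) : (border Om i 0 d).det = d * (border Om i 0 1).det := by
  conv_lhs => rw [border_zero_eq_updateRow, det_updateRow_smul]
  congr 2
  conv_rhs => rw [border_zero_eq_updateRow, one_smul]

theorem border_zero_mulVec_single (d : ℝ) :
    border Om i 0 d *ᵥ Pi.single i 1 = d • Pi.single i 1 := by
  ext a
  by_cases ha : a = i <;> simp [border, ha]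

theorem single_vecMul_border_zero (d : ℝ) :
    Pi.single i 1 ᵥ* border Om i 0 d = d • Pi.single i 1 := by
  ext a
  by_cases ha : a = i <;> simp [border, ha]

variable {Om i}

/-- The quadratic form splits into `d * x i ^ 2` and the form of `Om` at `x` with its `i`-th
coordinate set to zero. -/
theorem border_zero_posDef (h : Om.PosDef) {d : ℝ} (hd : 0 < d) : (border Om i 0 d).PosDef := by
  have hsymm : Om.IsSymm := by simpa using h.isHermitian
  refine PosDef.of_dotProduct_mulVec_pos (by simpa using border_isSymm i hsymm 0 d) fun x hx => ?_
  have hsplit : star x ⬝ᵥ (border Om i 0 d *ᵥ x) =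
      d * x i ^ 2 + star (Function.update x i 0) ⬝ᵥ (Om *ᵥ Function.update x i 0) := by
    have h1 : ∀ a, (border Om i 0 d *ᵥ x) a =
        if a = i then d * x i else (Om *ᵥ Function.update x i 0) a := by
      intro a
      simp only [mulVec, dotProduct]
      split_ifs with ha
      · rw [Finset.sum_eq_single i] <;> simp +contextual [border, ha]
      · refine Finset.sum_congr rfl fun b _ => ?_
        by_cases hb : b = i <;> simp [border, ha, hb]
    simp only [dotProduct, h1, star_trivial]
    rw [← Finset.add_sum_erase _ _ (Finset.mem_univ i),
      ← Finset.add_sum_erase (a := i) (f := fun a => Function.update x i 0 a * _) _ (Finset.mem_univ i)]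
    simp only [if_true, Function.update_self, zero_mul, zero_add]
    congr 1
    · ring
    · refine Finset.sum_congr rfl fun a ha => ?_
      have := Finset.ne_of_mem_erase ha
      simp [this]
  rw [hsplit]
  by_cases hxi : x i = 0
  · have : Function.update x i 0 = x := by rw [← hxi, Function.update_eq_self]
    rw [this, hxi]
    simpa using h.dotProduct_mulVec_pos hx
  · have h2 := h.posSemidef.dotProduct_mulVec_nonneg (Function.update x i 0)
    have : 0 < d * x i ^ 2 := by positivity
    linarith

theorem border_inv_mulVec_single (hO : IsUnit (border Om i 0 1).det) :
    (border Om i 0 1)⁻¹ *ᵥ Pi.single i 1 = Pi.single i 1 := by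
  have h := border_zero_mulVec_single Om i 1
  rw [one_smul] at h
  conv_lhs => rw [← h]
  rw [mulVec_mulVec, nonsing_inv_mul _ hO, one_mulVec]

theorem single_vecMul_border_inv (hO : IsUnit (border Om i 0 1).det) :
    Pi.single i 1 ᵥ* (border Om i 0 1)⁻¹ = Pi.single i 1 := by
  have h := single_vecMul_border_zero Om i 1
  rw [one_smul] at h
  conv_lhs => rw [← h]
  rw [vecMul_vecMul, mul_nonsing_inv _ hO, vecMul_one]

theorem vecMul_border_inv_apply_self (hO : IsUnit (border Om i 0 1).det) (w : V → ℝ) :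
    (w ᵥ* (border Om i 0 1)⁻¹) i = w i := by
  have h := congrArg (fun z => w ⬝ᵥ z) (border_inv_mulVec_single hO)
  simp only [dotProduct_mulVec] at h
  simpa using h

theorem border_zero_inv (hO : IsUnit (border Om i 0 1).det) {d : ℝ} (hd : d ≠ 0) :
    (border Om i 0 d)⁻¹ =
    (border Om i 0 1)⁻¹ + (d⁻¹ - 1) • vecMulVec (Pi.single i 1) (Pi.single i 1) := by
  refine inv_eq_right_inv ?_
  have h1 : border Om i 0 d * vecMulVec (Pi.single i 1) (Pi.single i 1) =
      d • vecMulVec (Pi.single i 1) (Pi.single i 1) := by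
    rw [mul_vecMulVec, border_zero_mulVec_single, smul_vecMulVec]
  rw [mul_add, Matrix.mul_smul, h1, border_zero_eq_add, add_mul, mul_nonsing_inv _ hO,
    Matrix.smul_mul, vecMulVec_mul, single_vecMul_border_inv hO, smul_smul, add_assoc, ← add_smul]
  have h2 : d - 1 + (d⁻¹ - 1) * d = 0 := by field_simp; ring
  rw [h2, zero_smul, add_zero]

/-- The factorization of a bordered matrix by a congruence with determinant one. -/
theorem border_eq_mul (hO : IsUnit (border Om i 0 1).det) (hs : Om.IsSymm) {w : V → ℝ} (hw : w i = 0) (d : ℝ) :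
    border Om i w (d + w ᵥ* (border Om i 0 1)⁻¹ ⬝ᵥ w) =
      (1 + vecMulVec (Pi.single i 1) (w ᵥ* (border Om i 0 1)⁻¹)) * border Om i 0 d *
        (1 + vecMulVec (Pi.single i 1) (w ᵥ* (border Om i 0 1)⁻¹))ᵀ := by
  set u := w ᵥ* (border Om i 0 1)⁻¹ with hu
  have hui : u i = 0 := by rw [hu, vecMul_border_inv_apply_self hO, hw]
  -- Since `u i = 0`, the diagonal entry `d` plays no role here.
  have h1 : u ᵥ* border Om i 0 d = w := by
    rw [border_zero_eq_add, vecMul_add, hu, vecMul_vecMul, nonsing_inv_mul _ hO, vecMul_one, ← hu,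
      vecMul_smul, vecMul_vecMulVec]
    simp [hui]
  have h2 : border Om i 0 d *ᵥ u = w := by
    rw [← vecMul_transpose, (border_isSymm i hs 0 d).eq, h1]
  rw [transpose_add, transpose_one, transpose_vecMulVec, mul_add, mul_one, mul_vecMulVec,
    add_mul, one_mul, vecMulVec_mul, h1, add_mulVec, h2, vecMulVec_mulVec]
  ext a b
  rw [dotProduct_comm]
  by_cases ha : a = i <;> by_cases hb : b = i <;>
    simp [border, vecMulVec_apply, ha, hb, hw]

theorem det_one_add_vecMulVec_single {u : V → ℝ} (hu : u i = 0) :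
    (1 + vecMulVec (Pi.single i 1) u : Matrix V V ℝ).det = 1 := by
  have : (1 + vecMulVec (Pi.single i 1) u : Matrix V V ℝ) =
      (1 : Matrix V V ℝ).updateRow i (Pi.single i 1 + u) := by
    ext a b
    by_cases ha : a = i
    · subst ha
      simp [vecMulVec_apply, one_apply, Pi.single_apply, eq_comm]
    · simp [vecMulVec_apply, ha]
  rw [this, det_updateRow_eq_dotProduct, adjugate_one]
  simp [dotProduct, one_apply, hu]

end Matrix

/-! ### Coordinates for the block update problem -/

namespace Matrix

theorem trace_vecMulVec_mul_mul_transpose {m n : Type*} [Fintype m] [Fintype n] (q : m → ℝ)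
    (Y : Matrix m n ℝ) :
    (vecMulVec q q * (Y * Yᵀ)).trace = (q ᵥ* Y) ⬝ᵥ (q ᵥ* Y) := by
  rw [vecMulVec_mul, trace_vecMulVec, dotProduct_comm, ← vecMul_vecMul, ← dotProduct_mulVec,
    mulVec_transpose]

variable {V : Type*} [Fintype V] [DecidableEq V] {Om : Matrix V V ℝ} {i : V}

/-- The `i`-th row of `F` is zero and `e_i` is an eigenvector of the block diagonal matrix, so there
are no cross terms. This separates the fixed part of the trace from the residual at `i`. -/
theorem transpose_mul_border_zero_inv_mul (hO : IsUnit (border Om i 0 1).det) {d : ℝ} (hd : d ≠ 0)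
    {F : Matrix V V ℝ} (hF : Pi.single i 1 ᵥ* F = 0) (q : V → ℝ) :
    (F + vecMulVec (Pi.single i 1) q)ᵀ * (border Om i 0 d)⁻¹ * (F + vecMulVec (Pi.single i 1) q) =
      Fᵀ * (border Om i 0 1)⁻¹ * F + d⁻¹ • vecMulVec q q := by
  have h1 : Fᵀ *ᵥ Pi.single i 1 = 0 := by rw [mulVec_transpose, hF]
  have h2 : (F + vecMulVec (Pi.single i 1) q)ᵀ *ᵥ Pi.single i 1 = q := by
    rw [transpose_add, add_mulVec, h1, transpose_vecMulVec, vecMulVec_mulVec]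
    simp
  have h3 : Pi.single i 1 ᵥ* (F + vecMulVec (Pi.single i 1) q) = q := by
    rw [vecMul_add, hF, vecMul_vecMulVec]
    simp
  have h4 : (F + vecMulVec (Pi.single i 1) q)ᵀ * (border Om i 0 1)⁻¹ =
      Fᵀ * (border Om i 0 1)⁻¹ + vecMulVec q (Pi.single i 1) := by
    rw [transpose_add, add_mul, transpose_vecMulVec, vecMulVec_mul, single_vecMul_border_inv hO]
  have h5 : (F + vecMulVec (Pi.single i 1) q)ᵀ * (border Om i 0 1)⁻¹ *
      (F + vecMulVec (Pi.single i 1) q) = Fᵀ * (border Om i 0 1)⁻¹ * F + vecMulVec q q := by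
    rw [h4, add_mul, vecMulVec_mul, h3, mul_add, mul_vecMulVec, ← mulVec_mulVec,
      border_inv_mulVec_single hO, h1, zero_vecMulVec, add_zero]
  rw [border_zero_inv hO hd, Matrix.mul_add _ (border Om i 0 1)⁻¹, add_mul, h5, Matrix.mul_smul,
    Matrix.smul_mul, mul_vecMulVec, h2, vecMulVec_mul, h3, add_assoc]
  congr 1
  rw [sub_smul, one_smul]
  abel

end Matrix

namespace MixedGraph

open Matrix

theorem isSymm_of_mem_OmegaSet {V : Type*} {G : MixedGraph V} {Om : Matrix V V ℝ} (h : Om ∈ G.OmegaSet) : Om.IsSymm := by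
  simpa using h.1.isHermitian

variable {V : Type*} [Fintype V] [DecidableEq V] (G : MixedGraph V) (i : V)

/-- The index set of the regression problem for the block update at `i`: the node `i` and its
parents, and the siblings of `i`. -/
inductive BlockIndex {V : Type*} (G : MixedGraph V) (i : V) : Type _
  | pa (j : V) (h : j = i ∨ G.dir j i)
  | sib (j : V) (h : G.bi.Adj j i)

instance : Finite (G.BlockIndex i) :=
  Finite.of_injective (β := V ⊕ V) (fun k => match k with | .pa j _ => .inl j | .sib j _ => .inr j)
    (by rintro (_ | _) (_ | _) h <;> simp_all)

noncomputable instance : Fintype (G.BlockIndex i) := Fintype.ofFinite _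

noncomputable instance : DecidableEq (G.BlockIndex i) := Classical.decEq _

/-- The index of the node `i` itself. -/
def blockSelf : G.BlockIndex i := .pa i (Or.inl rfl)

/-- The incidence matrix of the indices that stand for `i` and its parents. -/
def paIncidence : Matrix (G.BlockIndex i) V ℝ :=
  of fun k j => match k with
    | .pa a _ => if a = j then 1 else 0
    | .sib _ _ => 0

/-- The incidence matrix of the indices that stand for the siblings of `i`. -/
def sibIncidence : Matrix (G.BlockIndex i) V ℝ :=
  of fun k j => match k with
    | .pa _ _ => 0
    | .sib a _ => if a = j then 1 else 0

variable {G i}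

theorem vecMul_paIncidence_apply (v : G.BlockIndex i → ℝ) (j : V) (h : j = i ∨ G.dir j i) :
    (v ᵥ* G.paIncidence i) j = v (.pa j h) := by
  rw [vecMul, dotProduct, Finset.sum_eq_single (.pa j h)]
  · simp [paIncidence]
  · rintro (⟨a, ha⟩ | ⟨a, ha⟩) - hne
    · have : a ≠ j := fun e => hne (by subst e; rfl)
      simp [paIncidence, this]
    · simp [paIncidence]
  · simp

theorem vecMul_paIncidence_apply_of_not (v : G.BlockIndex i → ℝ) (j : V)
    (h : ¬ (j = i ∨ G.dir j i)) : (v ᵥ* G.paIncidence i) j = 0 := by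
  rw [vecMul, dotProduct]
  refine Finset.sum_eq_zero ?_
  rintro (⟨a, ha⟩ | ⟨a, ha⟩) -
  · have : a ≠ j := fun e => h (e ▸ ha)
    simp [paIncidence, this]
  · simp [paIncidence]

theorem vecMul_sibIncidence_apply (v : G.BlockIndex i → ℝ) (j : V) (h : G.bi.Adj j i) :
    (v ᵥ* G.sibIncidence i) j = v (.sib j h) := by
  rw [vecMul, dotProduct, Finset.sum_eq_single (.sib j h)]
  · simp [sibIncidence]
  · rintro (⟨a, ha⟩ | ⟨a, ha⟩) - hne
    · simp [sibIncidence]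
    · have : a ≠ j := fun e => hne (by subst e; rfl)
      simp [sibIncidence, this]
  · simp

theorem vecMul_sibIncidence_apply_of_not (v : G.BlockIndex i → ℝ) (j : V)
    (h : ¬ G.bi.Adj j i) : (v ᵥ* G.sibIncidence i) j = 0 := by
  rw [vecMul, dotProduct]
  refine Finset.sum_eq_zero ?_
  rintro (⟨a, ha⟩ | ⟨a, ha⟩) -
  · simp [sibIncidence]
  · have : a ≠ j := fun e => h (e ▸ ha)
    simp [sibIncidence, this]

theorem vecMul_sibIncidence_self (v : G.BlockIndex i → ℝ) : (v ᵥ* G.sibIncidence i) i = 0 :=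
  vecMul_sibIncidence_apply_of_not v i (G.bi.loopless.irrefl i)

theorem eq_of_vecMul_incidence_eq {v v' : G.BlockIndex i → ℝ}
    (h1 : v ᵥ* G.paIncidence i = v' ᵥ* G.paIncidence i)
    (h2 : v ᵥ* G.sibIncidence i = v' ᵥ* G.sibIncidence i) : v = v' := by
  ext k
  rcases k with ⟨j, hj⟩ | ⟨s, hs⟩
  · have := congrFun h1 j
    rwa [vecMul_paIncidence_apply v j hj, vecMul_paIncidence_apply v' j hj] at this
  · have := congrFun h2 s
    rwa [vecMul_sibIncidence_apply v s hs, vecMul_sibIncidence_apply v' s hs] at this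

theorem exists_vecMul_incidence_eq {r w : V → ℝ} (hr : ∀ j, j ≠ i → ¬ G.dir j i → r j = 0)
    (hw : ∀ j, ¬ G.bi.Adj j i → w j = 0) :
    ∃ v : G.BlockIndex i → ℝ, v ᵥ* G.paIncidence i = r ∧ v ᵥ* G.sibIncidence i = w := by
  refine ⟨fun k => match k with | .pa j _ => r j | .sib j _ => w j, ?_, ?_⟩
  · ext j
    by_cases hj : j = i ∨ G.dir j i
    · rw [vecMul_paIncidence_apply _ j hj]
    · rw [vecMul_paIncidence_apply_of_not _ j hj]
      rw [not_or] at hj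
      rw [hr j hj.1 hj.2]
  · ext j
    by_cases hj : G.bi.Adj j i
    · rw [vecMul_sibIncidence_apply _ j hj]
    · rw [vecMul_sibIncidence_apply_of_not _ j hj, hw j hj]

variable (G i)

/-- The rows of the regression problem, as linear combinations of the rows of the data matrix. -/
noncomputable def blockRows (θ : Matrix V V ℝ × Matrix V V ℝ) : Matrix (G.BlockIndex i) V ℝ :=
  G.paIncidence i + G.sibIncidence i * ((border θ.2 i 0 1)⁻¹ * (1 - θ.1))

/-- The Gram matrix of the regression problem. -/
noncomputable def blockGram {N : ℕ} (Y : Matrix V (Fin N) ℝ) (θ : Matrix V V ℝ × Matrix V V ℝ) :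
    Matrix (G.BlockIndex i) (G.BlockIndex i) ℝ :=
  (G.blockRows i θ * Y) * (G.blockRows i θ * Y)ᵀ

/-- The coefficients of `det (1 - B)` as a linear function of the `i`-th row. -/
noncomputable def blockCofactor (θ : Matrix V V ℝ × Matrix V V ℝ) : G.BlockIndex i → ℝ :=
  G.paIncidence i *ᵥ fun j => (1 - θ.1).adjugate j i

/-- The point of the block update problem with coordinates `v` and `η`. -/
noncomputable def blockPoint (θ : Matrix V V ℝ × Matrix V V ℝ) (v : G.BlockIndex i → ℝ) (η : ℝ) :
    Matrix V V ℝ × Matrix V V ℝ :=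
  (θ.1.updateRow i (Pi.single i 1 - v ᵥ* G.paIncidence i),
    border θ.2 i (-(v ᵥ* G.sibIncidence i))
      (η + (-(v ᵥ* G.sibIncidence i)) ᵥ* (border θ.2 i 0 1)⁻¹ ⬝ᵥ (-(v ᵥ* G.sibIncidence i))))

variable {G i} {θ : Matrix V V ℝ × Matrix V V ℝ}

theorem one_sub_blockPoint_fst (v : G.BlockIndex i → ℝ) (η : ℝ) :
    1 - (G.blockPoint i θ v η).1 = (1 - θ.1).updateRow i (v ᵥ* G.paIncidence i) :=
  updateRow_one_sub _ _ _

/-- Laplace expansion along row `i`, whose cofactors do not involve that row. -/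
theorem det_one_sub_blockPoint_fst (v : G.BlockIndex i → ℝ) (η : ℝ) :
    (1 - (G.blockPoint i θ v η).1).det = G.blockCofactor i θ ⬝ᵥ v := by
  rw [one_sub_blockPoint_fst, det_updateRow_eq_dotProduct, blockCofactor, dotProduct_comm _ v,
    dotProduct_mulVec]

theorem isUnit_det_border_of_mem_OmegaSet {Om : Matrix V V ℝ} (h : Om ∈ G.OmegaSet) :
    IsUnit (border Om i 0 1).det :=
  (border_zero_posDef h.1 one_pos).det_pos.ne'.isUnit

theorem neg_vecMul_sibIncidence_self (v : G.BlockIndex i → ℝ) :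
    (-(v ᵥ* G.sibIncidence i)) i = 0 := by
  rw [Pi.neg_apply, vecMul_sibIncidence_self, neg_zero]

theorem isUnit_one_add_vecMulVec {u : V → ℝ} (hu : u i = 0) :
    IsUnit (1 + vecMulVec (Pi.single i 1) u : Matrix V V ℝ) := by
  rw [Matrix.isUnit_iff_isUnit_det, det_one_add_vecMulVec_single hu]
  exact isUnit_one

/-- The congruence `border_eq_mul` reduces positive definiteness to `0 < η`; the normalization of
`v` says that `B` keeps a zero diagonal entry at `i`. -/
theorem blockPoint_mem (hB : θ.1 ∈ G.BSet) (hO : θ.2 ∈ G.OmegaSet) {v : G.BlockIndex i → ℝ}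
    (hv : v (G.blockSelf i) = 1) {η : ℝ} (hη : 0 < η) (hc : G.blockCofactor i θ ⬝ᵥ v ≠ 0) :
    G.blockPoint i θ v η ∈ G.blockFeasible i θ := by
  refine ⟨⟨?_, ?_⟩, ⟨?_, ?_⟩, ?_, ?_⟩
  · rw [Matrix.isUnit_iff_isUnit_det, det_one_sub_blockPoint_fst]
    exact hc.isUnit
  · intro a b hab
    by_cases ha : a = i
    · subst ha
      simp only [blockPoint, updateRow_self, Pi.sub_apply]
      by_cases hb : b = a
      · subst hb
        rw [vecMul_paIncidence_apply v b (Or.inl rfl), Pi.single_eq_same]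
        exact sub_eq_zero.2 hv.symm
      · rw [vecMul_paIncidence_apply_of_not v b (by tauto), Pi.single_eq_of_ne hb, sub_zero]
    · simp only [blockPoint, updateRow_ne ha]
      exact hB.2 a b hab
  · have hui := vecMul_border_inv_apply_self (isUnit_det_border_of_mem_OmegaSet (i := i) hO)
      (-(v ᵥ* G.sibIncidence i))
    rw [neg_vecMul_sibIncidence_self] at hui
    simp only [blockPoint]
    rw [border_eq_mul (isUnit_det_border_of_mem_OmegaSet hO) (isSymm_of_mem_OmegaSet hO)
      (neg_vecMul_sibIncidence_self v)]
    exact (IsUnit.posDef_star_right_conjugate_iff (isUnit_one_add_vecMulVec hui)).2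
      (border_zero_posDef hO.1 hη)
  · intro a b hab hadj
    simp only [blockPoint, border, of_apply]
    split_ifs with ha hb hb
    · exact absurd (ha.trans hb.symm) hab
    · subst ha
      rw [Pi.neg_apply, vecMul_sibIncidence_apply_of_not v b hadj, neg_zero]
    · subst hb
      rw [Pi.neg_apply, vecMul_sibIncidence_apply_of_not v a fun h => hadj h.symm, neg_zero]
    · exact hO.2 a b hab hadj
  · intro a b ha
    simp [blockPoint, updateRow_ne ha]
  · intro a b ha hb
    simp [blockPoint, border, ha, hb]

theorem exists_eq_blockPoint (hO : θ.2 ∈ G.OmegaSet)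
    {θ' : Matrix V V ℝ × Matrix V V ℝ} (h : θ' ∈ G.blockFeasible i θ) :
    ∃ (v : G.BlockIndex i → ℝ) (η : ℝ), v (G.blockSelf i) = 1 ∧ 0 < η ∧
      G.blockCofactor i θ ⬝ᵥ v ≠ 0 ∧ G.blockPoint i θ v η = θ' := by
  obtain ⟨hB', hO', hrow, hblk⟩ := h
  have hsymm := isSymm_of_mem_OmegaSet hO'
  let w : V → ℝ := fun j => if j = i then 0 else θ'.2 i j
  obtain ⟨v, hv1, hv2⟩ := exists_vecMul_incidence_eq (G := G) (i := i) (r := (1 - θ'.1) i)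
    (w := -w) (fun j hj hd => by
      simp [one_apply, hj.symm, hB'.2 i j hd]) (fun j hj => by
      by_cases h : j = i
      · simp [w, h]
      · simp [w, h, hO'.2 i j (Ne.symm h) hj])
  have hOu := isUnit_det_border_of_mem_OmegaSet (i := i) hO
  -- The Schur complement at `i`; its positivity follows from the same congruence, read backwards.
  let η := θ'.2 i i - w ᵥ* (border θ.2 i 0 1)⁻¹ ⬝ᵥ w
  have hself : v (G.blockSelf i) = 1 := by
    have := congrFun hv1 i
    rw [vecMul_paIncidence_apply v i (Or.inl rfl)] at this
    rw [blockSelf, this]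
    simp [hB'.2 i i (G.dir_irrefl i)]
  have hpt : G.blockPoint i θ v η = θ' := by
    refine Prod.ext ?_ ?_
    · ext a b
      by_cases ha : a = i
      · subst ha
        simp [blockPoint, hv1, Pi.single_apply, one_apply, eq_comm]
      · simp [blockPoint, updateRow_ne ha, hrow a b ha]
    · ext a b
      simp only [blockPoint, hv2, neg_neg, border, of_apply]
      split_ifs with ha hb hb
      · subst ha; subst hb
        simp [η, border]
      · subst ha; simp [w, hb]
      · subst hb; simp [w, ha, hsymm.apply]
      · exact (hblk a b ha hb).symm
  have hη : 0 < η := by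
    have hpd := hO'.1
    have hui := vecMul_border_inv_apply_self hOu (-(v ᵥ* G.sibIncidence i))
    rw [neg_vecMul_sibIncidence_self] at hui
    rw [← hpt] at hpd
    simp only [blockPoint] at hpd
    rw [border_eq_mul hOu (isSymm_of_mem_OmegaSet hO) (neg_vecMul_sibIncidence_self v)] at hpd
    have := (IsUnit.posDef_star_right_conjugate_iff (isUnit_one_add_vecMulVec hui)).1 hpd
    simpa [border] using this.diag_pos (i := i)
  refine ⟨v, η, hself, hη, ?_, hpt⟩
  rw [← det_one_sub_blockPoint_fst v η, hpt]
  exact ((Matrix.isUnit_iff_isUnit_det _).1 hB'.1).ne_zero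

theorem blockPoint_injective {v v' : G.BlockIndex i → ℝ} {η η' : ℝ}
    (h : G.blockPoint i θ v η = G.blockPoint i θ v' η') : v = v' ∧ η = η' := by
  have h1 : v ᵥ* G.paIncidence i = v' ᵥ* G.paIncidence i := by
    have := congrFun (congrArg Prod.fst h) i
    simpa [blockPoint] using this
  have h2 : v ᵥ* G.sibIncidence i = v' ᵥ* G.sibIncidence i := by
    ext j
    by_cases hj : j = i
    · subst hj; rw [vecMul_sibIncidence_self, vecMul_sibIncidence_self]
    · have := congrFun (congrFun (congrArg Prod.snd h) i) j
      simpa [blockPoint, border, hj] using this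
  refine ⟨eq_of_vecMul_incidence_eq h1 h2, ?_⟩
  have := congrFun (congrFun (congrArg Prod.snd h) i) i
  simpa [blockPoint, border, h2] using this

theorem dotProduct_blockGram_mulVec {N : ℕ} (Y : Matrix V (Fin N) ℝ) (v v' : G.BlockIndex i → ℝ) :
    v ⬝ᵥ G.blockGram i Y θ *ᵥ v' =
      (v ᵥ* G.blockRows i θ ᵥ* Y) ⬝ᵥ (v' ᵥ* G.blockRows i θ ᵥ* Y) := by
  rw [blockGram, ← mulVec_mulVec, dotProduct_mulVec, mulVec_transpose, vecMul_vecMul,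
    vecMul_vecMul]

/-- The log-likelihood function in the coordinates of the block update problem. -/
theorem logLik_blockPoint {N : ℕ} (Y : Matrix V (Fin N) ℝ) (hO : θ.2 ∈ G.OmegaSet) :
    ∃ K : ℝ, ∀ (v : G.BlockIndex i → ℝ) (η : ℝ), 0 < η → G.blockCofactor i θ ⬝ᵥ v ≠ 0 →
      logLik Y (G.blockPoint i θ v η) = K + Real.log ((G.blockCofactor i θ ⬝ᵥ v) ^ 2 / η) -
        (v ⬝ᵥ G.blockGram i Y θ *ᵥ v) / (N * η) := by
  have hOu := isUnit_det_border_of_mem_OmegaSet (i := i) hO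
  have hdpos : 0 < (border θ.2 i 0 1).det := (border_zero_posDef hO.1 one_pos).det_pos
  -- The part of `1 - B` that the update leaves alone; its contribution to the trace belongs to `K`.
  let F := (1 - θ.1).updateRow i 0
  have hF0 : Pi.single i 1 ᵥ* F = 0 := by
    ext b
    simp [F]
  refine ⟨- Real.log (border θ.2 i 0 1).det -
    (Fᵀ * (border θ.2 i 0 1)⁻¹ * F * ((1 / (N : ℝ)) • (Y * Yᵀ))).trace, fun v η hη hc => ?_⟩
  set w := -(v ᵥ* G.sibIncidence i) with hw
  set u := w ᵥ* (border θ.2 i 0 1)⁻¹ with hu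
  have hui : u i = 0 := by
    rw [hu, vecMul_border_inv_apply_self hOu, hw, neg_vecMul_sibIncidence_self]
  set T : Matrix V V ℝ := 1 + vecMulVec (Pi.single i 1) u with hT
  have hOm : (G.blockPoint i θ v η).2 = T * border θ.2 i 0 η * Tᵀ :=
    border_eq_mul hOu (isSymm_of_mem_OmegaSet hO) (neg_vecMul_sibIncidence_self v) η
  have hTdet : T.det = 1 := det_one_add_vecMulVec_single hui
  have hTinv : T⁻¹ = 1 - vecMulVec (Pi.single i 1) u := by
    refine inv_eq_right_inv ?_
    rw [hT, add_mul, one_mul, mul_sub, mul_one, vecMulVec_mul_vecMulVec]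
    simp [hui]
  set Q := 1 - (G.blockPoint i θ v η).1 with hQ
  have hQ' : Q = (1 - θ.1).updateRow i (v ᵥ* G.paIncidence i) := one_sub_blockPoint_fst v η
  have hQdet : Q.det = G.blockCofactor i θ ⬝ᵥ v := det_one_sub_blockPoint_fst v η
  have huQ : u ᵥ* Q = u ᵥ* (1 - θ.1) := by
    ext b
    simp only [vecMul, dotProduct]
    refine Finset.sum_congr rfl fun a _ => ?_
    by_cases ha : a = i
    · rw [ha, hui, zero_mul, zero_mul]
    · rw [hQ', updateRow_ne ha]
  -- After the triangular factor is removed, only row `i` depends on the block, and it is linear in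
  -- `v`; the sign in `w` turns the difference into a sum.
  have hTQ : T⁻¹ * Q = F + vecMulVec (Pi.single i 1) (v ᵥ* G.blockRows i θ) := by
    rw [hTinv, sub_mul, one_mul, vecMulVec_mul, huQ, hu, hw, blockRows, vecMul_add, hQ']
    ext a b
    by_cases ha : a = i
    · subst ha
      simp [F, vecMulVec_apply, vecMul_vecMul, neg_vecMul, Matrix.mul_assoc]
    · simp [F, vecMulVec_apply, ha]
  have hdet : (Q⁻¹ * (G.blockPoint i θ v η).2 * Q⁻¹ᵀ).det =
      η * (border θ.2 i 0 1).det / (G.blockCofactor i θ ⬝ᵥ v) ^ 2 := by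
    rw [det_mul, det_mul, det_transpose, det_nonsing_inv, Ring.inverse_eq_inv', hQdet, hOm, det_mul,
      det_mul, det_transpose, hTdet, det_border_zero]
    field_simp
  have htr : Qᵀ * (G.blockPoint i θ v η).2⁻¹ * Q = Fᵀ * (border θ.2 i 0 1)⁻¹ * F +
      η⁻¹ • vecMulVec (v ᵥ* G.blockRows i θ) (v ᵥ* G.blockRows i θ) := by
    rw [← transpose_mul_border_zero_inv_mul hOu hη.ne' hF0, ← hTQ, hOm, Matrix.mul_inv_rev,
      Matrix.mul_inv_rev, transpose_mul, transpose_nonsing_inv]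
    simp only [Matrix.mul_assoc]
  have hc2 : 0 < (G.blockCofactor i θ ⬝ᵥ v) ^ 2 := by positivity
  rw [logLik, ← hQ, hdet, htr, add_mul, trace_add, Matrix.smul_mul, trace_smul,
    Matrix.mul_smul (vecMulVec _ _), trace_smul, trace_vecMulVec_mul_mul_transpose, dotProduct_blockGram_mulVec,
    Real.log_div (by positivity) hc2.ne', Real.log_mul hη.ne' hdpos.ne',
    Real.log_div hc2.ne' hη.ne']
  simp only [smul_eq_mul, _root_.mul_inv_rev, div_eq_mul_inv, one_mul]
  ring

end MixedGraph

/-! ### Solutions of the block update problem -/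

namespace MixedGraph

open Matrix

section Objective

variable {κ : Type*} [Fintype κ] (N : ℕ) (A : Matrix κ κ ℝ) (c : κ → ℝ)

/-- The objective function of the block update problem, up to an additive constant. -/
noncomputable def blockObjective (v : κ → ℝ) (η : ℝ) : ℝ :=
  Real.log ((c ⬝ᵥ v) ^ 2 / η) - (v ⬝ᵥ A *ᵥ v) / (N * η)

variable {N A c}

/-- The objective function is bounded by `log (N κ) - 1`, where `κ = u ⬝ᵥ A u` and `A u = c`, and
only points on the line spanned by `u` may attain this bound. -/
theorem blockObjective_le (hN : 0 < N) (hA : A.PosDef) {u : κ → ℝ} (hu : A *ᵥ u = c)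
    (hu0 : u ≠ 0) {v : κ → ℝ} {η : ℝ} (hη : 0 < η) (hc : c ⬝ᵥ v ≠ 0) :
    blockObjective N A c v η ≤ Real.log (N * (c ⬝ᵥ u)) - 1 ∧
      (Real.log (N * (c ⬝ᵥ u)) - 1 ≤ blockObjective N A c v η →
        v = ((c ⬝ᵥ v) / (c ⬝ᵥ u)) • u ∧ η = (v ⬝ᵥ A *ᵥ v) / N) := by
  have hN' : (0 : ℝ) < N := Nat.cast_pos.2 hN
  have hsymm : A.IsSymm := by simpa using hA.isHermitian
  have hv0 : v ≠ 0 := by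
    rintro rfl
    exact hc (dotProduct_zero _)
  have hpos : ∀ x : κ → ℝ, x ≠ 0 → 0 < x ⬝ᵥ A *ᵥ x := fun x hx => by
    simpa using hA.dotProduct_mulVec_pos hx
  set k := c ⬝ᵥ u with hk
  set q := v ⬝ᵥ A *ᵥ v with hq
  set s := c ⬝ᵥ v with hs
  have hkpos : 0 < k := by
    rw [hk, ← hu, dotProduct_comm]
    exact hpos u hu0
  have hqpos : 0 < q := hpos v hv0
  have huv : u ⬝ᵥ A *ᵥ v = s := by
    rw [dotProduct_mulVec, ← mulVec_transpose, hsymm.eq, hu]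
  -- The squared `A`-distance from `v` to its projection on the line of `u`: nonnegativity is
  -- Cauchy–Schwarz, and it is zero only on that line.
  have hexp : (v - (s / k) • u) ⬝ᵥ A *ᵥ (v - (s / k) • u) = q - s ^ 2 / k := by
    rw [mulVec_sub, mulVec_smul, hu, sub_dotProduct, dotProduct_sub, dotProduct_sub, smul_dotProduct,
      smul_dotProduct, dotProduct_smul, dotProduct_smul, huv, dotProduct_comm v c,
      dotProduct_comm u c, ← hk, ← hs, ← hq]
    simp only [smul_eq_mul]
    field_simp
    ring
  have hs2 : 0 < s ^ 2 := by positivity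
  have hx : 0 < q / (N * η) := by positivity
  have hle : s ^ 2 ≤ k * q := by
    have h := hA.posSemidef.dotProduct_mulVec_nonneg (v - (s / k) • u)
    rw [star_trivial, hexp, sub_nonneg, div_le_iff₀ hkpos] at h
    linarith
  -- With `x = q / (N * η)` the variable part is a Cauchy–Schwarz defect plus `log x - x`, so the
  -- two inequalities can be saturated separately.
  have hobj : blockObjective N A c v η = Real.log (N * k) + Real.log (s ^ 2 / (k * q)) +
      Real.log (q / (N * η)) - q / (N * η) := by
    rw [blockObjective, ← hs, ← hq, ← Real.log_mul (by positivity) (by positivity),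
      ← Real.log_mul (by positivity) (by positivity)]
    congr 2
    field_simp
  have h1 : Real.log (s ^ 2 / (k * q)) ≤ 0 :=
    Real.log_nonpos (by positivity) ((div_le_one (by positivity)).2 hle)
  have h2 := Real.log_le_sub_one_of_pos hx
  refine ⟨by rw [hobj]; linarith, fun hge => ?_⟩
  rw [hobj] at hge
  constructor
  · by_contra hne
    have h := hpos _ (sub_ne_zero.2 hne)
    rw [hexp, sub_pos, div_lt_iff₀ hkpos] at h
    have : Real.log (s ^ 2 / (k * q)) < 0 :=
      Real.log_neg (by positivity) ((div_lt_one (by positivity)).2 (by linarith))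
    linarith
  · by_contra hne
    have hne1 : q / (N * η) ≠ 1 := fun h => hne (by
      field_simp at h ⊢
      linarith)
    have := Real.log_lt_sub_one_of_pos hx hne1
    linarith

/-- The objective is invariant under `(v, η) ↦ (r • v, r² * η)` for `r ≠ 0`, so the scale `t` is
free. -/
theorem blockObjective_eq (hN : 0 < N) (hA : A.PosDef) {u : κ → ℝ} (hu : A *ᵥ u = c)
    (hu0 : u ≠ 0) {t : ℝ} (ht : t ≠ 0) :
    blockObjective N A c (t⁻¹ • u) ((c ⬝ᵥ u) / (N * t ^ 2)) = Real.log (N * (c ⬝ᵥ u)) - 1 := by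
  have hN' : (0 : ℝ) < N := Nat.cast_pos.2 hN
  have hkpos : 0 < c ⬝ᵥ u := by
    rw [← hu, dotProduct_comm]
    simpa using hA.dotProduct_mulVec_pos hu0
  rw [blockObjective, mulVec_smul, hu, dotProduct_smul, dotProduct_smul, smul_dotProduct,
    dotProduct_comm u c]
  simp only [smul_eq_mul]
  congr 1
  · congr 1
    field_simp
  · field_simp

/-- If the quadratic form degenerates, then any point can be moved to another one without decreasing
the objective function. -/
theorem exists_blockObjective_ge (o : κ) {a : κ → ℝ} (ha0 : a ≠ 0) (hA : A.IsSymm)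
    (ha : A *ᵥ a = 0) {v : κ → ℝ} (hv : v o = 1) {η : ℝ} (hη : 0 < η) (hc : c ⬝ᵥ v ≠ 0) :
    ∃ (v' : κ → ℝ) (η' : ℝ), v' o = 1 ∧ 0 < η' ∧ c ⬝ᵥ v' ≠ 0 ∧ (v' ≠ v ∨ η' ≠ η) ∧
      blockObjective N A c v η ≤ blockObjective N A c v' η' := by
  -- The sign of `t` keeps `|c ⬝ᵥ v|` from decreasing along `a`, and its small size keeps the
  -- coordinate at `o` positive, so that rescaling by `m` restores the value one.
  obtain ⟨t, ht0, hto, htc⟩ : ∃ t : ℝ, t ≠ 0 ∧ 0 < 1 + t * a o ∧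
      0 ≤ t * ((c ⬝ᵥ v) * (c ⬝ᵥ a)) := by
    have hd : 0 < 1 + |a o| := by positivity
    have h1 : |(1 + |a o|)⁻¹ * a o| < 1 := by
      rw [abs_mul, abs_of_pos (inv_pos.2 hd), inv_mul_lt_one₀ hd]
      linarith
    rw [abs_lt] at h1
    rcases le_total 0 ((c ⬝ᵥ v) * (c ⬝ᵥ a)) with h | h
    · exact ⟨(1 + |a o|)⁻¹, by positivity, by linarith, by positivity⟩
    · refine ⟨-(1 + |a o|)⁻¹, by simpa using hd.ne', by linarith, ?_⟩
      exact mul_nonneg_of_nonpos_of_nonpos (by simpa using hd.le) h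
  set m := 1 + t * a o with hm
  have hcv : (c ⬝ᵥ v) ^ 2 ≤ (c ⬝ᵥ v + t * (c ⬝ᵥ a)) ^ 2 := by
    nlinarith [sq_nonneg (t * (c ⬝ᵥ a))]
  have hcv0 : 0 < (c ⬝ᵥ v) ^ 2 := by positivity
  have hc' : c ⬝ᵥ (m⁻¹ • (v + t • a)) = m⁻¹ * (c ⬝ᵥ v + t * (c ⬝ᵥ a)) := by
    rw [dotProduct_smul, dotProduct_add, dotProduct_smul, smul_eq_mul, smul_eq_mul]
  have hne : c ⬝ᵥ v + t * (c ⬝ᵥ a) ≠ 0 := fun h => by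
    rw [h] at hcv
    norm_num at hcv
    exact hc hcv
  refine ⟨m⁻¹ • (v + t • a), η / m ^ 2, ?_, by positivity, ?_, ?_, ?_⟩
  · rw [Pi.smul_apply, Pi.add_apply, Pi.smul_apply, hv, smul_eq_mul, smul_eq_mul, ← hm,
      inv_mul_cancel₀ hto.ne']
  · rw [hc']
    exact mul_ne_zero (inv_ne_zero hto.ne') hne
  · by_contra hcon
    simp only [not_or, ne_eq, not_not] at hcon
    obtain ⟨h1, h2⟩ := hcon
    have hm1 : m = 1 := by
      rw [div_eq_iff (by positivity)] at h2
      have : m ^ 2 = 1 := by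
        have := mul_left_cancel₀ hη.ne' (show η * m ^ 2 = η * 1 by linarith)
        exact this
      nlinarith
    rw [hm1, inv_one, one_smul, add_eq_left, smul_eq_zero] at h1
    exact h1.elim ht0 ha0
  · have hq : (m⁻¹ • (v + t • a)) ⬝ᵥ A *ᵥ (m⁻¹ • (v + t • a)) =
        (m⁻¹) ^ 2 * (v ⬝ᵥ A *ᵥ v) := by
      have hav : a ⬝ᵥ A *ᵥ v = 0 := by
        rw [dotProduct_mulVec, ← mulVec_transpose, hA.eq, ha, zero_dotProduct]
      rw [mulVec_smul, mulVec_add, mulVec_smul, ha, smul_zero, add_zero, dotProduct_smul,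
        smul_dotProduct, add_dotProduct, smul_dotProduct, hav]
      simp only [smul_eq_mul]
      ring
    have h1 : (m⁻¹) ^ 2 * (v ⬝ᵥ A *ᵥ v) / (N * (η / m ^ 2)) = (v ⬝ᵥ A *ᵥ v) / (N * η) := by
      -- For `N = 0` both quotients are zero by the convention on division.
      rcases Nat.eq_zero_or_pos N with rfl | hN
      · simp
      · have hN' : (0 : ℝ) < N := Nat.cast_pos.2 hN
        field_simp
    have h2 : (m⁻¹ * (c ⬝ᵥ v + t * (c ⬝ᵥ a))) ^ 2 / (η / m ^ 2) =
        (c ⬝ᵥ v + t * (c ⬝ᵥ a)) ^ 2 / η := by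
      field_simp
    rw [blockObjective, blockObjective, hq, hc', h1, h2]
    gcongr

end Objective

variable {V : Type*} [Fintype V] [DecidableEq V] {G : MixedGraph V} {i : V}
  {θ : Matrix V V ℝ × Matrix V V ℝ} {N : ℕ} {Y : Matrix V (Fin N) ℝ}

theorem blockGram_isSymm : (G.blockGram i Y θ).IsSymm := by
  rw [Matrix.IsSymm, blockGram, transpose_mul, transpose_transpose]

/-- If `x ⬝ᵥ A x = 0` for a Gram matrix `A`, then `A x = 0`. -/
theorem blockGram_posDef (h : (G.blockGram i Y θ).det ≠ 0) : (G.blockGram i Y θ).PosDef := by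
  refine PosDef.of_dotProduct_mulVec_pos (by simpa using blockGram_isSymm) fun x hx => ?_
  rw [star_trivial]
  have h1 := dotProduct_blockGram_mulVec (θ := θ) Y x x
  rw [h1]
  refine lt_of_le_of_ne (Finset.sum_nonneg fun j _ => mul_self_nonneg _) fun h0 => hx ?_
  have h2 := dotProduct_self_eq_zero.1 h0.symm
  refine eq_zero_of_mulVec_eq_zero h ?_
  rw [blockGram, ← mulVec_mulVec, mulVec_transpose, ← vecMul_vecMul, h2, mulVec_zero]

variable (G i Y θ)

/-- The solution of the normal equations of the block update problem. -/
noncomputable def blockNormal : G.BlockIndex i → ℝ :=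
  (G.blockGram i Y θ)⁻¹ *ᵥ G.blockCofactor i θ

/-- The result of the block update at `i`. -/
noncomputable def blockUpdate : Matrix V V ℝ × Matrix V V ℝ :=
  G.blockPoint i θ ((G.blockNormal i θ Y (G.blockSelf i))⁻¹ • G.blockNormal i θ Y)
    ((G.blockCofactor i θ ⬝ᵥ G.blockNormal i θ Y) / (N * G.blockNormal i θ Y (G.blockSelf i) ^ 2))

variable {G i Y θ}

/-- Nondegenerate block updates are unique and feasible, and given by a rational formula. -/
theorem isBlockSolution_blockUpdate (hN : 0 < N) (hB : θ.1 ∈ G.BSet) (hO : θ.2 ∈ G.OmegaSet)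
    (hA : (G.blockGram i Y θ).det ≠ 0) (h0 : G.blockNormal i θ Y (G.blockSelf i) ≠ 0) :
    G.IsBlockSolution Y i θ (G.blockUpdate i θ Y) ∧
      ∀ θ', G.IsBlockSolution Y i θ θ' → θ' = G.blockUpdate i θ Y := by
  obtain ⟨K, hK⟩ := logLik_blockPoint (i := i) Y hO
  have hpd := blockGram_posDef hA
  set u := G.blockNormal i θ Y with hu
  set t := u (G.blockSelf i) with ht
  set c := G.blockCofactor i θ with hc
  have hAu : G.blockGram i Y θ *ᵥ u = c := by
    rw [hu, blockNormal, mulVec_mulVec, mul_nonsing_inv _ hA.isUnit, one_mulVec]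
  have hu0 : u ≠ 0 := fun h => h0 (by rw [ht, h]; rfl)
  have hN' : (0 : ℝ) < N := Nat.cast_pos.2 hN
  have hkpos : 0 < c ⬝ᵥ u := by
    rw [← hAu, dotProduct_comm]
    simpa using hpd.dotProduct_mulVec_pos hu0
  have hη : 0 < (c ⬝ᵥ u) / (N * t ^ 2) := by positivity
  have hcv : c ⬝ᵥ (t⁻¹ • u) ≠ 0 := by
    rw [dotProduct_smul, smul_eq_mul]
    exact mul_ne_zero (inv_ne_zero h0) hkpos.ne'
  have hself : (t⁻¹ • u) (G.blockSelf i) = 1 := by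
    rw [Pi.smul_apply, smul_eq_mul, ← ht, inv_mul_cancel₀ h0]
  have hval : ∀ v η, 0 < η → c ⬝ᵥ v ≠ 0 → logLik Y (G.blockPoint i θ v η) =
      K + blockObjective N (G.blockGram i Y θ) c v η := fun v η h1 h2 => by
    rw [hK v η h1 h2, blockObjective]
    ring
  have hopt : logLik Y (G.blockUpdate i θ Y) = K + (Real.log (N * (c ⬝ᵥ u)) - 1) := by
    rw [blockUpdate, hval _ _ hη hcv, blockObjective_eq hN hpd hAu hu0 h0]
  have hmem : G.blockUpdate i θ Y ∈ G.blockFeasible i θ := blockPoint_mem hB hO hself hη hcv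
  refine ⟨⟨hmem, fun θ' hθ' => ?_⟩, fun θ' hθ' => ?_⟩
  · obtain ⟨v, η, -, hη', hcv', rfl⟩ := exists_eq_blockPoint hO hθ'
    change logLik Y _ ≤ logLik Y _
    rw [hopt, hval v η hη' hcv']
    linarith [(blockObjective_le hN hpd hAu hu0 hη' hcv').1]
  · obtain ⟨v, η, hv, hη', hcv', rfl⟩ := exists_eq_blockPoint hO hθ'.1
    have hge : logLik Y _ ≤ logLik Y _ := hθ'.2 hmem
    rw [hopt, hval v η hη' hcv'] at hge
    obtain ⟨h1, h2⟩ := (blockObjective_le hN hpd hAu hu0 hη' hcv').2 (by linarith)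
    -- Among the points on the line of `u`, the normalization at `i` leaves only one.
    have hvt : v = t⁻¹ • u := by
      have h3 := congrFun h1 (G.blockSelf i)
      rw [hv, Pi.smul_apply, smul_eq_mul, ← ht] at h3
      rw [h1, eq_inv_of_mul_eq_one_left h3.symm]
    rw [blockUpdate, ← hu, ← ht, ← hc, hvt, h2, hvt]
    congr 1
    rw [mulVec_smul, hAu, dotProduct_smul, smul_dotProduct, dotProduct_comm u c]
    simp only [smul_eq_mul]
    field_simp

/-- A block update whose regression problem has linearly dependent rows is not unique. -/
theorem not_unique_of_vecMul_eq_zero (hB : θ.1 ∈ G.BSet) (hO : θ.2 ∈ G.OmegaSet)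
    {a : G.BlockIndex i → ℝ} (ha0 : a ≠ 0) (ha : a ᵥ* G.blockRows i θ = 0)
    {θ' : Matrix V V ℝ × Matrix V V ℝ} (h : G.IsBlockSolution Y i θ θ') :
    ∃ θ'', G.IsBlockSolution Y i θ θ'' ∧ θ'' ≠ θ' := by
  obtain ⟨K, hK⟩ := logLik_blockPoint (i := i) Y hO
  obtain ⟨v, η, hv, hη, hc, rfl⟩ := exists_eq_blockPoint hO h.1
  have hAa : G.blockGram i Y θ *ᵥ a = 0 := by
    rw [blockGram, ← mulVec_mulVec, mulVec_transpose, ← vecMul_vecMul, ha, zero_vecMul,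
      mulVec_zero]
  obtain ⟨v', η', hv', hη', hc', hne, hle⟩ := exists_blockObjective_ge (N := N) (G.blockSelf i) ha0
    blockGram_isSymm hAa hv hη hc
  refine ⟨G.blockPoint i θ v' η', ⟨blockPoint_mem hB hO hv' hη' hc', fun x hx => ?_⟩, fun heq => ?_⟩
  · have hx' : logLik Y x ≤ logLik Y (G.blockPoint i θ v η) := h.2 hx
    refine hx'.trans ?_
    rw [hK v η hη hc, hK v' η' hη' hc']
    simp only [blockObjective] at hle
    linarith
  · obtain ⟨h1, h2⟩ := blockPoint_injective heq
    exact hne.elim (fun h => h h1) (fun h => h h2)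

end MixedGraph

/-! ### Nondegeneracy of the regression problem and the half-collider condition -/

namespace MixedGraph

open Matrix

section Rows

variable {V : Type*} [Fintype V] [DecidableEq V] {G : MixedGraph V} {i : V}
  {θ : Matrix V V ℝ × Matrix V V ℝ} {N : ℕ} {Y : Matrix V (Fin N) ℝ}

/-- A vector `z` violating the rank condition on `G_{-i}` gives a relation between the rows: after
extension by zero at `i`, the sibling coefficients are `z Ω` and the coefficients at `i` and its
parents are `-z (1 - B)`. -/
theorem halfColliderCondition_of_blockRows (hB : θ.1 ∈ G.BSet) (hO : θ.2 ∈ G.OmegaSet)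
    (h : ∀ a, a ᵥ* G.blockRows i θ = 0 → a = 0) : G.HalfColliderCondition i := by
  have hOu := isUnit_det_border_of_mem_OmegaSet (i := i) hO
  have hsys := exists_system_of_vecMul (G.induce {i}ᶜ) {v | (v : V) ∈ G.sib i}
    {v | (v : V) ∉ G.pa i} (K := (1 - θ.1).submatrix Subtype.val Subtype.val)
    (Om := θ.2.submatrix Subtype.val Subtype.val)
    (hO.1.submatrix Subtype.val_injective).det_pos.ne'.isUnit
    (fun u v huv hadj => hO.2 u v (fun h => huv (Subtype.ext h)) fun h => hadj h.symm)
    (fun u v huv hdir => by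
      have huv' : (u : V) ≠ v := fun h => huv (Subtype.ext h)
      simp [one_apply, huv', hB.2 u v hdir]) (fun z hz1 hz2 => by
      let x : V → ℝ := fun v => if hv : v ∈ ({i}ᶜ : Set V) then z ⟨v, hv⟩ else 0
      have hxi : x i = 0 := dif_neg (by simp)
      have hxz : ∀ v : ({i}ᶜ : Set V), x v = z v := fun v => dif_pos v.2
      have hsub : ∀ (M : Matrix V V ℝ) (b : ({i}ᶜ : Set V)),
          (x ᵥ* M) b = (z ᵥ* M.submatrix Subtype.val Subtype.val) b := by
        intro M b
        simp only [vecMul, dotProduct, submatrix_apply]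
        refine (Fintype.sum_of_injective Subtype.val Subtype.val_injective _ _ (fun v hv => ?_)
          fun v => by rw [hxz]).symm
        rw [show x v = 0 from dif_neg fun h => hv ⟨⟨v, h⟩, rfl⟩, zero_mul]
      have hxb : x ᵥ* border θ.2 i 0 1 = fun b => if b = i then 0 else (x ᵥ* θ.2) b := by
        ext b
        simp only [vecMul, dotProduct]
        split_ifs with hb
        · refine Finset.sum_eq_zero fun a _ => ?_
          by_cases ha : a = i
          · rw [ha, hxi, zero_mul]
          · simp [border, ha, hb]
        · refine Finset.sum_congr rfl fun a _ => ?_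
          by_cases ha : a = i
          · rw [ha, hxi, zero_mul, zero_mul]
          · simp [border, ha, hb]
      have hxinv : x = (x ᵥ* border θ.2 i 0 1) ᵥ* (border θ.2 i 0 1)⁻¹ := by
        rw [vecMul_vecMul, mul_nonsing_inv _ hOu, vecMul_one]
      obtain ⟨v, hv1, hv2⟩ := exists_vecMul_incidence_eq (G := G) (i := i)
        (r := -(x ᵥ* (1 - θ.1))) (w := x ᵥ* border θ.2 i 0 1) (fun j hj hd => by
          rw [Pi.neg_apply, hsub _ ⟨j, hj⟩, hz2 ⟨j, hj⟩ hd, neg_zero]) (fun j hj => by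
          rw [hxb]
          by_cases hji : j = i
          · simp [hji]
          · simp only [hji, if_false]
            rw [hsub _ ⟨j, hji⟩, hz1 ⟨j, hji⟩ hj])
      have hv0 : v = 0 := h v (by
        rw [blockRows, vecMul_add, hv1, ← vecMul_vecMul, hv2, ← vecMul_vecMul, ← hxinv,
          neg_add_cancel])
      rw [hv0, zero_vecMul] at hv2
      rw [← hv2, zero_vecMul] at hxinv
      ext v
      rw [← hxz, hxinv]
      rfl)
  obtain ⟨Sb, hSb, hP⟩ := hsys
  refine ⟨Sb, fun v hv => ?_, hP⟩
  rintro (h1 | h1)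
  · exact hSb hv h1
  · exact v.2 h1

/-- Away from `i` and its parents only the sibling rows are visible, so their coefficients vanish
first and the others follow. The matrices need not lie in `BSet` and `OmegaSet`: they only witness
that a determinant is not identically zero. -/
theorem exists_blockRows_of_halfColliderCondition (h : G.HalfColliderCondition i) :
    ∃ B Om : Matrix V V ℝ, (∀ u v, ¬ G.dir v u → B u v = 0) ∧ Om.IsSymm ∧
      (∀ u v, u ≠ v → ¬ G.bi.Adj v u → Om u v = 0) ∧ (border Om i 0 1).det ≠ 0 ∧
      ∀ a, a ᵥ* G.blockRows i (B, Om) = 0 → a = 0 := by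
  obtain ⟨B, Om, hB, hs, hO, hi, hii, hdet, hy⟩ := G.exists_matrices_of_halfColliderCondition i h
  have hbor : border Om i 0 1 = Om := by
    ext a b
    by_cases ha : a = i <;> by_cases hb : b = i
    · simp [border, ha, hb, hii]
    · simp [border, ha, hb, hi b hb]
    · simp [border, ha, hb, ← hs.apply a i, hi a ha]
    · simp [border, ha, hb]
  refine ⟨B, Om, hB, hs, hO, by rwa [hbor], fun a ha => ?_⟩
  rw [blockRows, vecMul_add, hbor, ← vecMul_vecMul] at ha
  have hsib : a ᵥ* G.sibIncidence i = 0 := by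
    refine hy _ (fun v hv => vecMul_sibIncidence_apply_of_not a v hv) fun c hci hcd => ?_
    have := congrFun ha c
    rwa [Pi.add_apply, vecMul_paIncidence_apply_of_not a c (by tauto), zero_add] at this
  rw [hsib, zero_vecMul, add_zero] at ha
  exact eq_of_vecMul_incidence_eq (by rw [ha, zero_vecMul]) (by rw [hsib, zero_vecMul])

theorem eq_zero_of_vecMul_blockRows (h : (G.blockGram i Y θ).det ≠ 0) {a : G.BlockIndex i → ℝ}
    (ha : a ᵥ* G.blockRows i θ = 0) : a = 0 := by
  refine eq_zero_of_mulVec_eq_zero h ?_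
  rw [blockGram, ← mulVec_mulVec, mulVec_transpose, ← vecMul_vecMul, ha, zero_vecMul, mulVec_zero]

/-- With data of full row rank, degeneracy depends only on `θ`. This allows the data to be exchanged
later. -/
theorem det_blockGram_ne_zero (hY : ∀ x, x ᵥ* Y = 0 → x = 0)
    (h : ∀ a, a ᵥ* G.blockRows i θ = 0 → a = 0) : (G.blockGram i Y θ).det ≠ 0 := by
  intro h0
  obtain ⟨a, ha0, ha⟩ := exists_mulVec_eq_zero_iff.2 h0
  refine ha0 (h a (hY _ ?_))
  rw [← dotProduct_self_eq_zero, ← dotProduct_blockGram_mulVec, ha, dotProduct_zero]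

/-- At a point where the sample covariance matrix is the model covariance matrix, nondegenerate block
updates change nothing. -/
theorem blockUpdate_eq_self (hN : 0 < N) (hB : θ.1 ∈ G.BSet) (hO : θ.2 ∈ G.OmegaSet)
    (hY : Y * Yᵀ = (N : ℝ) • ((1 - θ.1)⁻¹ * θ.2 * (1 - θ.1)⁻¹ᵀ))
    (hA : (G.blockGram i Y θ).det ≠ 0) :
    G.blockNormal i θ Y (G.blockSelf i) ≠ 0 ∧ G.blockUpdate i θ Y = θ := by
  have hN' : (0 : ℝ) < N := Nat.cast_pos.2 hN
  have hOu := isUnit_det_border_of_mem_OmegaSet (i := i) hO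
  have hdet : IsUnit (1 - θ.1).det := (Matrix.isUnit_iff_isUnit_det _).1 hB.1
  obtain ⟨v, η, hv, hη, hc, hpt⟩ := exists_eq_blockPoint (i := i) hO
    (show θ ∈ G.blockFeasible i θ from ⟨hB, hO, fun _ _ _ => rfl, fun _ _ _ _ => rfl⟩)
  set e : V → ℝ := Pi.single i 1 with he
  set w := -(v ᵥ* G.sibIncidence i) with hw
  set u := w ᵥ* (border θ.2 i 0 1)⁻¹ with hu
  have hui : u i = 0 := by
    rw [hu, vecMul_border_inv_apply_self hOu, hw, neg_vecMul_sibIncidence_self]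
  have hpa : v ᵥ* G.paIncidence i = e ᵥ* (1 - θ.1) := by
    have h1 := one_sub_blockPoint_fst (θ := θ) v η
    rw [hpt] at h1
    have h2 := congrFun h1 i
    rw [updateRow_self] at h2
    rw [← h2, he, single_one_vecMul]
    rfl
  have hrows : v ᵥ* G.blockRows i θ = (e - u) ᵥ* (1 - θ.1) := by
    rw [blockRows, vecMul_add, hpa, ← vecMul_vecMul, ← vecMul_vecMul, sub_vecMul, hu, hw,
      neg_vecMul, neg_vecMul, sub_neg_eq_add]
  -- The residual of regressing the error at `i` on the other errors is uncorrelated with them.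
  have hOmu : θ.2 *ᵥ (e - u) = η • e := by
    have h1 : θ.2 = (1 + vecMulVec e u) * border θ.2 i 0 η * (1 + vecMulVec e u)ᵀ := by
      have := border_eq_mul hOu (isSymm_of_mem_OmegaSet hO) (neg_vecMul_sibIncidence_self v) η
      conv_lhs => rw [← congrArg Prod.snd hpt]
      exact this
    have h2 : (1 + vecMulVec e u)ᵀ *ᵥ (e - u) = e := by
      rw [transpose_add, transpose_one, transpose_vecMulVec, add_mulVec, one_mulVec,
        vecMulVec_mulVec]
      simp [he, hui]
    have h3 : (1 + vecMulVec e u) *ᵥ e = e := by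
      rw [add_mulVec, one_mulVec, vecMulVec_mulVec]
      simp [he, hui]
    rw [h1, ← mulVec_mulVec, ← mulVec_mulVec, h2, he, border_zero_mulVec_single, mulVec_smul, ← he,
      h3]
  have hsib : G.sibIncidence i *ᵥ e = 0 := by
    ext k
    rw [he, mulVec_single_one]
    rcases k with ⟨j, hj⟩ | ⟨j, hj⟩
    · rfl
    · exact if_neg hj.ne
  have hcof : G.paIncidence i *ᵥ ((1 - θ.1)⁻¹ *ᵥ e) =
      (1 - θ.1).det⁻¹ • G.blockCofactor i θ := by
    rw [blockCofactor, ← mulVec_smul]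
    congr 1
    ext j
    rw [he, mulVec_single_one, inv_def, Ring.inverse_eq_inv']
    rfl
  -- The coordinates of `θ` itself solve the normal equations up to a nonzero factor, which the
  -- normalization removes.
  have hgram : G.blockGram i Y θ *ᵥ v =
      (N * η * (1 - θ.1).det⁻¹) • G.blockCofactor i θ := by
    have h1 : (Y * Yᵀ) *ᵥ ((e - u) ᵥ* (1 - θ.1)) = (N * η) • ((1 - θ.1)⁻¹ *ᵥ e) := by
      rw [hY, smul_mulVec, ← mulVec_mulVec, ← mulVec_transpose, mulVec_mulVec _ _ (1 - θ.1)ᵀ,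
        ← transpose_mul, mul_nonsing_inv _ hdet, transpose_one, one_mulVec, ← mulVec_mulVec, hOmu,
        mulVec_smul, smul_smul]
    rw [blockGram, ← mulVec_mulVec, mulVec_transpose, ← vecMul_vecMul, hrows, ← mulVec_transpose Y,
      ← mulVec_mulVec, mulVec_mulVec _ Y, h1, mulVec_smul, blockRows, add_mulVec, hcof,
      ← mulVec_mulVec, mulVec_mulVec _ _ (1 - θ.1)⁻¹, Matrix.mul_assoc, mul_nonsing_inv _ hdet,
      mul_one, he, border_inv_mulVec_single hOu, ← he, hsib, add_zero, smul_smul]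
  have hcv : G.blockCofactor i θ ⬝ᵥ v = (1 - θ.1).det := by
    rw [← det_one_sub_blockPoint_fst v η, hpt]
  have hd0 := hdet.ne_zero
  have hnormal : G.blockNormal i θ Y = ((1 - θ.1).det / (N * η)) • v := by
    have h1 : G.blockCofactor i θ = G.blockGram i Y θ *ᵥ (((1 - θ.1).det / (N * η)) • v) := by
      rw [mulVec_smul, hgram, smul_smul]
      field_simp
      rw [one_smul]
    rw [blockNormal, h1, mulVec_mulVec, nonsing_inv_mul _ hA.isUnit, one_mulVec]
  have hs : (1 - θ.1).det / (N * η) ≠ 0 := by positivity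
  refine ⟨?_, ?_⟩
  · rw [hnormal, Pi.smul_apply, hv, smul_eq_mul, mul_one]
    exact hs
  · conv_rhs => rw [← hpt]
    rw [blockUpdate, hnormal, Pi.smul_apply, hv, smul_eq_mul, mul_one, smul_smul,
      inv_mul_cancel₀ hs, one_smul, dotProduct_smul, hcv, smul_eq_mul]
    congr 1
    field_simp

end Rows

end MixedGraph

/-! ### Block-coordinate descent for generic data and starting values -/

namespace MixedGraph

open Matrix

section Regular

variable {V : Type*} [Fintype V] [DecidableEq V] {G : MixedGraph V}
  {E : Type*} [NormedAddCommGroup E] [NormedSpace ℝ E] [MeasurableSpace E] {p : E} {N : ℕ}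
  {Y : E → Matrix V (Fin N) ℝ} {θ : E → Matrix V V ℝ × Matrix V V ℝ} {i : V}

theorem matrixRegularAt_border {V : Type*} [DecidableEq V] {i : V} {Om : E → Matrix V V ℝ}
    (hO : MatrixRegularAt p Om) {w : E → V → ℝ} (hw : ∀ k, RegularAt p fun x => w x k) {d : E → ℝ} (hd : RegularAt p d) :
    MatrixRegularAt p fun x => border (Om x) i (w x) (d x) := by
  intro a b
  simp only [border, of_apply]
  split_ifs
  exacts [hd, hw b, hw a, hO a b]

theorem regularAt_vecMul {m n : Type*} [Fintype m] {v : E → m → ℝ}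
    (hv : ∀ k, RegularAt p fun x => v x k) {M : E → Matrix m n ℝ} (hM : MatrixRegularAt p M) (j : n) :
    RegularAt p fun x => (v x ᵥ* M x) j :=
  RegularAt.sum _ fun k _ => (hv k).mul (hM k j)

theorem regularAt_mulVec {m n : Type*} [Fintype n] {v : E → n → ℝ}
    (hv : ∀ k, RegularAt p fun x => v x k) {M : E → Matrix m n ℝ} (hM : MatrixRegularAt p M) (j : m) :
    RegularAt p fun x => (M x *ᵥ v x) j :=
  RegularAt.sum _ fun k _ => (hM j k).mul (hv k)

theorem regularAt_dotProduct {m : Type*} [Fintype m] {v w : E → m → ℝ}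
    (hv : ∀ k, RegularAt p fun x => v x k) (hw : ∀ k, RegularAt p fun x => w x k) :
    RegularAt p fun x => v x ⬝ᵥ w x :=
  RegularAt.sum _ fun k _ => (hv k).mul (hw k)

theorem matrixRegularAt_border_inv (h2 : MatrixRegularAt p fun x => (θ x).2)
    (h0 : (border (θ p).2 i 0 1).det ≠ 0) :
    MatrixRegularAt p fun x => (border (θ x).2 i 0 1)⁻¹ :=
  MatrixRegularAt.inv (matrixRegularAt_border h2 (fun _ => RegularAt.const 0) (RegularAt.const 1)) h0

theorem matrixRegularAt_blockGram (hY : MatrixRegularAt p Y)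
    (h1 : MatrixRegularAt p fun x => (θ x).1) (h2 : MatrixRegularAt p fun x => (θ x).2)
    (h0 : (border (θ p).2 i 0 1).det ≠ 0) :
    MatrixRegularAt p fun x => G.blockGram i (Y x) (θ x) := by
  have hrows : MatrixRegularAt p fun x => G.blockRows i (θ x) := fun a b =>
    (RegularAt.const _).add ((MatrixRegularAt.const _).mul
      ((matrixRegularAt_border_inv h2 h0).mul ((MatrixRegularAt.const 1).sub h1)) a b)
  exact (hrows.mul hY).mul (hrows.mul hY).transpose

theorem regularAt_blockCofactor (h1 : MatrixRegularAt p fun x => (θ x).1) (k : G.BlockIndex i) :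
    RegularAt p fun x => G.blockCofactor i (θ x) k :=
  regularAt_mulVec (fun j => ((MatrixRegularAt.const 1).sub h1).adjugate j i)
    (MatrixRegularAt.const _) k

theorem regularAt_blockNormal (hY : MatrixRegularAt p Y)
    (h1 : MatrixRegularAt p fun x => (θ x).1) (h2 : MatrixRegularAt p fun x => (θ x).2)
    (h0 : (border (θ p).2 i 0 1).det ≠ 0) (hA : (G.blockGram i (Y p) (θ p)).det ≠ 0)
    (k : G.BlockIndex i) : RegularAt p fun x => G.blockNormal i (θ x) (Y x) k :=
  regularAt_mulVec (regularAt_blockCofactor h1)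
    ((matrixRegularAt_blockGram hY h1 h2 h0).inv hA) k

theorem matrixRegularAt_blockPoint (h1 : MatrixRegularAt p fun x => (θ x).1)
    (h2 : MatrixRegularAt p fun x => (θ x).2) (h0 : (border (θ p).2 i 0 1).det ≠ 0)
    {v : E → G.BlockIndex i → ℝ} (hv : ∀ k, RegularAt p fun x => v x k) {η : E → ℝ}
    (hη : RegularAt p η) :
    (MatrixRegularAt p fun x => (G.blockPoint i (θ x) (v x) (η x)).1) ∧
      MatrixRegularAt p fun x => (G.blockPoint i (θ x) (v x) (η x)).2 := by
  have hw : ∀ k, RegularAt p fun x => (-(v x ᵥ* G.sibIncidence i)) k := fun k =>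
    (regularAt_vecMul hv (MatrixRegularAt.const _) k).neg
  refine ⟨fun a b => ?_, ?_⟩
  · by_cases ha : a = i
    · subst ha
      simp only [blockPoint, updateRow_self]
      exact (RegularAt.const _).sub (regularAt_vecMul hv (MatrixRegularAt.const _) b)
    · simp only [blockPoint, updateRow_ne ha]
      exact h1 a b
  · exact matrixRegularAt_border h2 hw (hη.add (regularAt_dotProduct
      (regularAt_vecMul hw (matrixRegularAt_border_inv h2 h0)) hw))

theorem matrixRegularAt_blockUpdate (hN : 0 < N) (hY : MatrixRegularAt p Y)
    (h1 : MatrixRegularAt p fun x => (θ x).1) (h2 : MatrixRegularAt p fun x => (θ x).2)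
    (h0 : (border (θ p).2 i 0 1).det ≠ 0) (hA : (G.blockGram i (Y p) (θ p)).det ≠ 0)
    (hn : G.blockNormal i (θ p) (Y p) (G.blockSelf i) ≠ 0) :
    (MatrixRegularAt p fun x => (G.blockUpdate i (θ x) (Y x)).1) ∧
      MatrixRegularAt p fun x => (G.blockUpdate i (θ x) (Y x)).2 := by
  have hnormal := regularAt_blockNormal hY h1 h2 h0 hA
  have hN' : (N : ℝ) ≠ 0 := Nat.cast_ne_zero.2 hN.ne'
  refine matrixRegularAt_blockPoint h1 h2 h0 (fun k => ?_) ?_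
  · exact ((hnormal _).inv hn).mul (hnormal k)
  · refine (regularAt_dotProduct (regularAt_blockCofactor h1) hnormal).div
      ((RegularAt.const _).mul ?_) (mul_ne_zero hN' (pow_ne_zero 2 hn))
    simpa only [pow_two] using (hnormal _).mul (hnormal _)

/-- Almost everywhere, block-coordinate descent along a list of nodes has unique and feasible updates,
if there is a point with nondegenerate regression problems where the sample covariance matrix is the
model covariance matrix. -/
theorem ae_uniqueFeasibleUpdates [BorelSpace E] [FiniteDimensional ℝ E] (μ : Measure E)
    [μ.IsAddHaarMeasure] (hcard : Fintype.card V ≤ N) (hY : MatrixRegularAt p Y)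
    {θ₀ : Matrix V V ℝ × Matrix V V ℝ} (hB : θ₀.1 ∈ G.BSet) (hO : θ₀.2 ∈ G.OmegaSet)
    (hS : Y p * (Y p)ᵀ = (N : ℝ) • ((1 - θ₀.1)⁻¹ * θ₀.2 * (1 - θ₀.1)⁻¹ᵀ))
    (hA : ∀ i, (G.blockGram i (Y p) θ₀).det ≠ 0) (l : List V)
    (hp : θ p = θ₀) (h1 : MatrixRegularAt p fun x => (θ x).1)
    (h2 : MatrixRegularAt p fun x => (θ x).2) :
    ∀ᵐ x ∂μ, (θ x).1 ∈ G.BSet → (θ x).2 ∈ G.OmegaSet →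
      G.UniqueFeasibleUpdates (Y x) l (θ x) := by
  induction l generalizing θ with
  | nil => exact Filter.Eventually.of_forall fun x _ _ => trivial
  | cons i l ih =>
    have hN : 0 < N := lt_of_lt_of_le (Fintype.card_pos_iff.2 ⟨i⟩) hcard
    obtain ⟨hn, hfix⟩ := blockUpdate_eq_self hN hB hO hS (hA i)
    have h0 : (border (θ p).2 i 0 1).det ≠ 0 := by
      rw [hp]
      exact (isUnit_det_border_of_mem_OmegaSet hO).ne_zero
    have hA' : (G.blockGram i (Y p) (θ p)).det ≠ 0 := by rw [hp]; exact hA i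
    have hn' : G.blockNormal i (θ p) (Y p) (G.blockSelf i) ≠ 0 := by rw [hp]; exact hn
    obtain ⟨h1', h2'⟩ := matrixRegularAt_blockUpdate hN hY h1 h2 h0 hA' hn'
    -- The induction runs over parameter maps with value `θ₀` at `p`. As `θ₀` is a fixed point, the
    -- updated map is again one, and its denominators do not vanish at `p`.
    have ih' := ih (θ := fun x => G.blockUpdate i (θ x) (Y x)) (by simp only [hp, hfix]) h1' h2'
    filter_upwards [(matrixRegularAt_blockGram hY h1 h2 h0).det.ae_ne_zero μ hA',
      (regularAt_blockNormal hY h1 h2 h0 hA' (G.blockSelf i)).ae_ne_zero μ hn', ih']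
      with x hx1 hx2 hx3 hxB hxO
    have hsol := isBlockSolution_blockUpdate hN hxB hxO hx1 hx2
    exact ⟨_, hsol, hx3 hsol.1.1.1 hsol.1.1.2.1⟩

end Regular

/-! ### Coordinates of the triples `(Y, B, Ω)`. -/

section Parameters

variable {V : Type*} (G : MixedGraph V)

theorem toOmega_isSymm [DecidableEq V] (ω : G.OmegaIndex → ℝ) : (G.toOmega ω).IsSymm := by
  refine IsSymm.ext fun a b => ?_
  by_cases hab : a = b
  · rw [hab]
  · have hba : b ≠ a := Ne.symm hab
    by_cases h : s(a, b) ∈ G.bi.edgeSet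
    · have h' : s(b, a) ∈ G.bi.edgeSet := by rwa [Sym2.eq_swap]
      simp only [toOmega, of_apply, hab, hba, if_false, h, h', dif_pos]
      exact congrArg (fun e => ω (Sum.inr e)) (Subtype.ext Sym2.eq_swap)
    · have h' : s(b, a) ∉ G.bi.edgeSet := by rwa [Sym2.eq_swap]
      simp only [toOmega, of_apply, hab, hba, if_false, h, h', dif_neg, not_false_eq_true]

theorem toOmega_apply_of_not_adj [DecidableEq V] (ω : G.OmegaIndex → ℝ) {a b : V} (hab : a ≠ b)
    (h : ¬ G.bi.Adj b a) : G.toOmega ω a b = 0 := by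
  have : s(a, b) ∉ G.bi.edgeSet := fun h' => h (SimpleGraph.Adj.symm h')
  simp [toOmega, hab, this]

theorem toB_apply_of_not_dir (β : G.DirEdge → ℝ) {a b : V} (h : ¬ G.dir b a) :
    G.toB β a b = 0 := by
  simp [toB, h]

theorem exists_toB_eq {B : Matrix V V ℝ} (hB : ∀ u v, ¬ G.dir v u → B u v = 0) :
    ∃ β, G.toB β = B := by
  refine ⟨fun e => B e.1.2 e.1.1, ?_⟩
  ext a b
  by_cases h : G.dir b a
  · simp [toB, h]
  · simp [toB, h, hB a b h]

theorem exists_toOmega_eq [DecidableEq V] {Om : Matrix V V ℝ} (hs : Om.IsSymm)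
    (hO : ∀ u v, u ≠ v → ¬ G.bi.Adj v u → Om u v = 0) : ∃ ω, G.toOmega ω = Om := by
  refine ⟨Sum.elim (fun i => Om i i) (fun e => Sym2.lift ⟨fun a b => Om a b, fun a b =>
    hs.apply b a⟩ e.1), ?_⟩
  ext a b
  by_cases hab : a = b
  · subst hab; simp [toOmega]
  · by_cases h : s(a, b) ∈ G.bi.edgeSet
    · simp only [toOmega, of_apply, hab, if_false, h, dif_pos, Sum.elim_inr, Sym2.lift_mk]
    · rw [hO a b hab fun h' => h (SimpleGraph.Adj.symm h')]
      simp only [toOmega, of_apply, hab, if_false, h, dif_neg, not_false_eq_true]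

theorem continuous_toB : Continuous G.toB := by
  refine continuous_matrix fun a b => ?_
  by_cases h : G.dir b a
  · simp only [toB, of_apply, h, dif_pos]
    fun_prop
  · simp only [toB, of_apply, h, dif_neg, not_false_eq_true]
    fun_prop

theorem continuous_toOmega [DecidableEq V] : Continuous G.toOmega := by
  refine continuous_matrix fun a b => ?_
  simp only [toOmega, of_apply]
  split_ifs <;> fun_prop

variable [Fintype V] [Fintype G.DirEdge] [Fintype G.OmegaIndex] (N : ℕ)

/-- The coordinates of triples `(Y, B, Ω)`. -/
abbrev TripleCoord (G : MixedGraph V) (N : ℕ) : Type _ :=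
  (V → Fin N → ℝ) × (G.DirEdge → ℝ) × (G.OmegaIndex → ℝ)

theorem isAddHaarMeasure_tripleCoord : (volume : Measure (G.TripleCoord N)).IsAddHaarMeasure := by
  have h1 : (volume : Measure (V → Fin N → ℝ)).IsAddHaarMeasure :=
    Measure.pi.isAddHaarMeasure _
  have h2 : (volume : Measure ((G.DirEdge → ℝ) × (G.OmegaIndex → ℝ))).IsAddHaarMeasure :=
    Measure.prod.instIsAddHaarMeasure _ _
  exact Measure.prod.instIsAddHaarMeasure _ _

theorem matrixRegularAt_data (p : G.TripleCoord N) :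
    MatrixRegularAt p fun x : G.TripleCoord N => of x.1 := fun a b =>
  RegularAt.of_continuousLinearMap ((ContinuousLinearMap.proj (φ := fun _ : Fin N => ℝ) b).comp
    ((ContinuousLinearMap.proj (φ := fun _ : V => Fin N → ℝ) a).comp
      (ContinuousLinearMap.fst ℝ (V → Fin N → ℝ) ((G.DirEdge → ℝ) × (G.OmegaIndex → ℝ)))))

theorem matrixRegularAt_toB (p : G.TripleCoord N) :
    MatrixRegularAt p fun x : G.TripleCoord N => G.toB x.2.1 := fun a b => by
  by_cases h : G.dir b a
  · simp only [toB, of_apply, h, dif_pos]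
    exact RegularAt.of_continuousLinearMap
      ((ContinuousLinearMap.proj (φ := fun _ : G.DirEdge => ℝ) ⟨(b, a), h⟩).comp
        ((ContinuousLinearMap.fst ℝ (G.DirEdge → ℝ) (G.OmegaIndex → ℝ)).comp
          (ContinuousLinearMap.snd ℝ (V → Fin N → ℝ) ((G.DirEdge → ℝ) × (G.OmegaIndex → ℝ)))))
  · simp only [toB, of_apply, h, dif_neg, not_false_eq_true]
    exact RegularAt.const 0

theorem regularAt_omegaCoord (p : G.TripleCoord N) (k : G.OmegaIndex) :
    RegularAt p fun x : G.TripleCoord N => x.2.2 k :=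
  RegularAt.of_continuousLinearMap
    ((ContinuousLinearMap.proj (φ := fun _ : G.OmegaIndex => ℝ) k).comp
      ((ContinuousLinearMap.snd ℝ (G.DirEdge → ℝ) (G.OmegaIndex → ℝ)).comp
        (ContinuousLinearMap.snd ℝ (V → Fin N → ℝ) ((G.DirEdge → ℝ) × (G.OmegaIndex → ℝ)))))

theorem matrixRegularAt_toOmega [DecidableEq V] (p : G.TripleCoord N) :
    MatrixRegularAt p fun x : G.TripleCoord N => G.toOmega x.2.2 := fun a b => by
  simp only [toOmega, of_apply]
  split_ifs with h1 h2
  · exact G.regularAt_omegaCoord N p _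
  · exact G.regularAt_omegaCoord N p _
  · exact RegularAt.const 0

end Parameters

end MixedGraph

/-! ### Positive definite and semidefinite matrices. -/

namespace Matrix

variable {V : Type*} [Fintype V]

open Topology in
/-- Positive definiteness is an open condition on symmetric matrices. -/
theorem PosDef.eventually_of_isSymm {A : Matrix V V ℝ} (hA : A.PosDef) :
    ∀ᶠ M in 𝓝 A, M.IsSymm → M.PosDef := by
  -- By homogeneity the unit sphere suffices, and its compactness makes the neighbourhood uniform in
  -- `x`.
  have key : ∀ᶠ M in 𝓝 A, ∀ x ∈ Metric.sphere (0 : V → ℝ) 1, 0 < x ⬝ᵥ M *ᵥ x := by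
    refine (isCompact_sphere (0 : V → ℝ) 1).eventually_forall_of_forall_eventually fun x hx => ?_
    have hcont : Continuous fun z : Matrix V V ℝ × (V → ℝ) => z.2 ⬝ᵥ z.1 *ᵥ z.2 := by fun_prop
    have hx0 : x ≠ 0 := by
      rintro rfl
      simp at hx
    refine hcont.continuousAt.eventually (lt_mem_nhds ?_)
    simpa using hA.dotProduct_mulVec_pos hx0
  filter_upwards [key] with M hM hs
  refine PosDef.of_dotProduct_mulVec_pos (by simpa using hs) fun x hx => ?_
  have hn : 0 < ‖x‖ := norm_pos_iff.2 hx
  have h := hM (‖x‖⁻¹ • x) (by simp [norm_smul, hn.ne'])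
  rw [mulVec_smul, dotProduct_smul, smul_dotProduct, smul_eq_mul, smul_eq_mul, ← mul_assoc] at h
  rw [star_trivial]
  exact (pos_iff_pos_of_mul_pos h).1 (by positivity)

open scoped MatrixOrder Matrix.Norms.L2Operator in
-- A square factor is padded with zero columns; this is where `N ≥ |V|` enters.
theorem PosSemidef.exists_mul_transpose [DecidableEq V] {S : Matrix V V ℝ} (hS : S.PosSemidef)
    {N : ℕ} (hN : Fintype.card V ≤ N) : ∃ Y : Matrix V (Fin N) ℝ, Y * Yᵀ = S := by
  obtain ⟨M, rfl⟩ := CStarAlgebra.nonneg_iff_eq_star_mul_self.mp hS.nonneg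
  obtain ⟨f⟩ : Nonempty (V ↪ Fin N) := Function.Embedding.nonempty_of_card_le (by simpa using hN)
  let J : Matrix V (Fin N) ℝ := of fun a k => if f a = k then 1 else 0
  have hJ : J * Jᵀ = 1 := by
    ext a b
    simp [J, mul_apply, one_apply, f.injective.eq_iff, eq_comm]
  refine ⟨Mᵀ * J, ?_⟩
  rw [transpose_mul, transpose_transpose, Matrix.mul_assoc, ← Matrix.mul_assoc J, hJ, one_mul,
    star_eq_conjTranspose, conjTranspose_eq_transpose_of_trivial]

end Matrix

/-! ### Generic nondegeneracy and the equivalence. -/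

namespace MixedGraph

open Matrix

variable {V : Type*} [Fintype V] [DecidableEq V] (G : MixedGraph V) (N : ℕ)

section Generic

variable [Fintype G.DirEdge] [Fintype G.OmegaIndex]

/-- The coordinates of the starting values in the parameter sets have nonempty interior. -/
theorem exists_feasible_of_ae {Q : G.TripleCoord N → Prop} (hQ : ∀ᵐ p, Q p) :
    ∃ p : G.TripleCoord N, Q p ∧ G.toB p.2.1 ∈ G.BSet ∧ G.toOmega p.2.2 ∈ G.OmegaSet := by
  have := G.isAddHaarMeasure_tripleCoord N
  obtain ⟨β, hβ⟩ := G.exists_toB_eq (B := 0) fun _ _ _ => rfl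
  obtain ⟨ω, hω⟩ := G.exists_toOmega_eq (Om := 1) isSymm_one fun u v huv _ => one_apply_ne huv
  have h1 : ∀ᶠ p in nhds ((0, β, ω) : G.TripleCoord N), (1 - G.toB p.2.1).det ≠ 0 := by
    have hcont : Continuous fun p : G.TripleCoord N => (1 - G.toB p.2.1).det :=
      (continuous_const.sub (G.continuous_toB.comp (by fun_prop))).matrix_det
    refine hcont.continuousAt.eventually_ne ?_
    simp [hβ]
  have h2 : ∀ᶠ p in nhds ((0, β, ω) : G.TripleCoord N), (G.toOmega p.2.2).PosDef := by
    have hcont : Continuous fun p : G.TripleCoord N => G.toOmega p.2.2 :=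
      G.continuous_toOmega.comp (by fun_prop)
    have hone : (G.toOmega ω).PosDef := by rw [hω]; exact PosDef.one
    filter_upwards [(hcont.tendsto (0, β, ω)).eventually hone.eventually_of_isSymm] with p hp
    exact hp (G.toOmega_isSymm _)
  obtain ⟨p, hp, hpQ⟩ := (Measure.dense_of_ae hQ).inter_nhds_nonempty (h1.and h2)
  refine ⟨p, hp, ⟨(Matrix.isUnit_iff_isUnit_det _).2 hpQ.1.isUnit, fun a b h => ?_⟩, hpQ.2,
    fun a b hab h => ?_⟩
  · exact G.toB_apply_of_not_dir _ h
  · exact G.toOmega_apply_of_not_adj _ hab h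

variable {G N}

theorem ae_det_blockGram_ne_zero (hN : Fintype.card V ≤ N) {i : V}
    (h : G.HalfColliderCondition i) :
    ∀ᵐ p : G.TripleCoord N, (G.blockGram i (of p.1) (G.toB p.2.1, G.toOmega p.2.2)).det ≠ 0 := by
  have := G.isAddHaarMeasure_tripleCoord N
  obtain ⟨B, Om, hB, hs, hO, hdet, hrows⟩ := exists_blockRows_of_halfColliderCondition h
  obtain ⟨β, rfl⟩ := G.exists_toB_eq hB
  obtain ⟨ω, rfl⟩ := G.exists_toOmega_eq hs hO
  obtain ⟨Y, hY⟩ := (PosDef.one (n := V) (R := ℝ)).posSemidef.exists_mul_transpose hN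
  let p : G.TripleCoord N := (Y, β, ω)
  refine (matrixRegularAt_blockGram (p := p) (Y := fun p : G.TripleCoord N => of p.1)
    (θ := fun p : G.TripleCoord N => (G.toB p.2.1, G.toOmega p.2.2)) (G.matrixRegularAt_data N p)
    (G.matrixRegularAt_toB N p) (G.matrixRegularAt_toOmega N p) hdet).det.ae_ne_zero volume ?_
  refine det_blockGram_ne_zero (fun x hx => ?_) hrows
  have hx' : x ᵥ* (Y * Yᵀ) = 0 := by
    rw [← vecMul_vecMul, show x ᵥ* Y = 0 from hx, zero_vecMul]
  rwa [hY, vecMul_one] at hx'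

theorem ae_uniqueFeasibleUpdates_of_halfColliderCondition (hN : Fintype.card V ≤ N)
    (h : ∀ i, G.HalfColliderCondition i) (l : List V) :
    ∀ᵐ p : G.TripleCoord N, G.toB p.2.1 ∈ G.BSet → G.toOmega p.2.2 ∈ G.OmegaSet →
      G.UniqueFeasibleUpdates (of p.1) l (G.toB p.2.1, G.toOmega p.2.2) := by
  have := G.isAddHaarMeasure_tripleCoord N
  -- Each node has its own witness, possibly outside the parameter sets; intersecting the generic
  -- sets gives one feasible point that serves all nodes.
  obtain ⟨⟨Y₁, β, ω⟩, hA, hB, hO⟩ := G.exists_feasible_of_ae N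
    (ae_all_iff.2 fun i => ae_det_blockGram_ne_zero hN (h i))
  have hS : ((1 - G.toB β)⁻¹ * G.toOmega ω * (1 - G.toB β)⁻¹ᵀ).PosDef := by
    have hu : IsUnit (1 - G.toB β)⁻¹ := by
      rw [Matrix.isUnit_nonsing_inv_iff]
      exact hB.1
    exact (IsUnit.posDef_star_right_conjugate_iff hu).2 hO.1
  -- Replace the data so that the sample covariance is the model covariance; nondegeneracy survives
  -- because the new data have full row rank.
  obtain ⟨Y, hY⟩ := (hS.posSemidef.smul (Nat.cast_nonneg (α := ℝ) N)).exists_mul_transpose hN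
  have hA' : ∀ i, (G.blockGram i Y (G.toB β, G.toOmega ω)).det ≠ 0 := fun i => by
    refine det_blockGram_ne_zero (fun x hx => ?_) fun a ha => eq_zero_of_vecMul_blockRows (hA i) ha
    have hN' : (N : ℝ) ≠ 0 :=
      Nat.cast_ne_zero.2 (lt_of_lt_of_le (Fintype.card_pos_iff.2 ⟨i⟩) hN).ne'
    have hx' : x ᵥ* (Y * Yᵀ) = 0 := by rw [← vecMul_vecMul, hx, zero_vecMul]
    rw [hY, vecMul_smul, smul_eq_zero] at hx'
    exact eq_zero_of_vecMul_eq_zero hS.det_pos.ne' (hx'.resolve_left hN')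
  exact ae_uniqueFeasibleUpdates (p := ((Y, β, ω) : G.TripleCoord N)) volume
    (Y := fun p : G.TripleCoord N => of p.1) (θ₀ := (G.toB β, G.toOmega ω))
    (θ := fun p : G.TripleCoord N => (G.toB p.2.1, G.toOmega p.2.2)) hN
    (G.matrixRegularAt_data N _) hB hO hY hA' l rfl (G.matrixRegularAt_toB N _)
    (G.matrixRegularAt_toOmega N _)

end Generic

variable {G N}

/-- When `i` is visited, the current point is feasible because all earlier updates were. -/
theorem exists_unique_solution_of_mem {Y : Matrix V (Fin N) ℝ} {l : List V}
    {θ : Matrix V V ℝ × Matrix V V ℝ} (h : G.UniqueFeasibleUpdates Y l θ) (hB : θ.1 ∈ G.BSet)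
    (hO : θ.2 ∈ G.OmegaSet) {i : V} (hi : i ∈ l) :
    ∃ θ₁ θ₂ : Matrix V V ℝ × Matrix V V ℝ, θ₁.1 ∈ G.BSet ∧ θ₁.2 ∈ G.OmegaSet ∧
      G.IsBlockSolution Y i θ₁ θ₂ ∧ ∀ θ₃, G.IsBlockSolution Y i θ₁ θ₃ → θ₃ = θ₂ := by
  induction l generalizing θ with
  | nil => simp at hi
  | cons j l ih =>
    obtain ⟨θ', ⟨h1, h2⟩, h3⟩ := h
    rcases List.mem_cons.1 hi with rfl | hi
    · exact ⟨θ, θ', hB, hO, h1, h2⟩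
    · exact ih h3 h1.1.1 h1.1.2.1 hi

end MixedGraph

theorem mainTheorem1 {V : Type*} [Fintype V] [DecidableEq V] (G : MixedGraph V) (N : ℕ)
    (hN : Fintype.card V ≤ N) (order : List V) (h_nodup : order.Nodup)
    (h_all : ∀ v, v ∈ order) :
    (∀ i : V, G.HalfColliderCondition i) ↔
      G.ForGenericTriples N (fun Y θ₀ =>
        ∀ T : ℕ, G.UniqueFeasibleUpdates Y (List.replicate T order).flatten θ₀) := by
  classical
  constructor
  · intro h
    -- Countably many null sets, one for each number of iterations.
    have hT := ae_all_iff.2 fun T : ℕ =>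
      MixedGraph.ae_uniqueFeasibleUpdates_of_halfColliderCondition hN h
        (List.replicate T order).flatten
    exact hT.mono fun p hp hB hO T => hp T hB hO
  · intro h i
    obtain ⟨p, hp, hB, hO⟩ := G.exists_feasible_of_ae N h
    -- One iteration visits every node.
    have h1 := hp hB hO 1
    rw [List.replicate_one, List.flatten_singleton] at h1
    obtain ⟨θ₁, θ₂, hB₁, hO₁, hsol, huniq⟩ :=
      MixedGraph.exists_unique_solution_of_mem h1 hB hO (h_all i)
    refine MixedGraph.halfColliderCondition_of_blockRows hB₁ hO₁ fun a ha => ?_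
    by_contra ha0
    obtain ⟨θ₃, h3, hne⟩ := MixedGraph.not_unique_of_vecMul_eq_zero hB₁ hO₁ ha0 ha hsol
    exact hne (huniq θ₃ h3)
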